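/- A digraph here is finite, and loops and multiarcs are allowed: it consists of a set of nodes and a finite multiset of arcs, i.e. ordered pairs (tail, head) of nodes. It is $k$-regular if every node is the tail of exactly $k$ arcs and the head of exactly $k$ arcs, counted with multiplicity (so a loop contributes one to both the outdegree and the indegree of its node). An unlabeled digraph is an isomorphism class of digraphs under bijections of the nodes that preserve the multiset of arcs. The components of a digraph are its weakly connected components, i.e. the connected components of the simple graph obtained by forgetting directions, multiplicities and loops. Let $U_2(n)$ be the number of unlabeled $2$-regular digraphs on $n$ nodes, and $U_2(n,c)$ the number of those with exactly $c$ components. Then for $1\le n\le 9$ and $1\le c\le 9$ the values of $U_2(n,c)$ and $U_2(n)$ are (blank entries are $0$) $$\begin{array}{r|rrrrrrrrr|r} n\backslash c & 1 & 2 & 3 & 4 & 5 & 6 & 7 & 8 & 9 & U_2(n)\\ \hline 1 & 1 &&&&&&&&& 1\\ 2 & 2 & 1 &&&&&&&& 3\\ 3 & 5 & 2 & 1 &&&&&&& 8\\ 4 & 14 & 8 & 2 & 1 &&&&&& 25\\ 5 & 50 & 24 & 8 & 2 & 1 &&&&& 85\\ 6 & 265 & 93 & 28 & 8 & 2 & 1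 &&&& 397\\ 7 & 1601 & 435 & 108 & 28 & 8 & 2 & 1 &&& 2183\\ 8 & 11984 & 2486 & 507 & 113 & 28 & 8 & 2 & 1 && 15129\\ 9 & 101884 & 17211 & 2811 & 527 & 113 & 28 & 8 & 2 & 1 & 122585 \end{array}$$ and in each row $U_2(n)=\sum_{c=1}^{n}U_2(n,c)$. Moreover, for every $n\ge 0$, sending a digraph with nodes labeled $1,\dots,n$ to its adjacency matrix (whose entry in row $r$ and column $c$ is the number of arcs from $r$ to $c$) induces a bijection from the unlabeled $2$-regular digraphs on $n$ nodes onto the orbits of the $n\times n$ matrices with nonnegative integer entries and all row and column sums equal to $2$ under simultaneous permutations of rows and columns. In particular, the number of these orbits is $1, 3, 8, 25, 85, 397, 2183, 15129, 122585$ for $n=1,\dots,9$. -/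

import Mathlib

/-- A digraph on the node set `V`, with loops and multiarcs allowed: a finite multiset of arcs,
each arc being recorded as the pair `(tail, head)`. -/
@[ext]
structure MultiDigraph (V : Type*) where
  /-- The multiset of arcs `(tail, head)`. -/
  arcs : Multiset (V × V)

namespace MultiDigraph

variable {V W : Type*}

/-- The number of arcs whose tail is `v`. -/
def outdegree [DecidableEq V] (D : MultiDigraph V) (v : V) : ℕ :=
  D.arcs.countP (fun a => a.1 = v)

/-- The number of arcs whose head is `v`. -/
def indegree [DecidableEq V] (D : MultiDigraph V) (v : V) : ℕ :=
  D.arcs.countP (fun a => a.2 = v)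

/-- `k`-regularity: every node has outdegree `k` and indegree `k`. -/
def IsRegular [DecidableEq V] (D : MultiDigraph V) (k : ℕ) : Prop :=
  ∀ v, D.outdegree v = k ∧ D.indegree v = k

/-- The adjacency matrix: the entry `(r, c)` is the number of arcs from `r` to `c`. -/
def adjMatrix [DecidableEq V] (D : MultiDigraph V) : Matrix V V ℕ :=
  Matrix.of fun r c => D.arcs.count (r, c)

/-- The underlying simple graph: directions, multiplicities and loops are forgotten. -/
def underlyingGraph (D : MultiDigraph V) : SimpleGraph V :=
  SimpleGraph.fromRel fun u v => (u, v) ∈ D.arcs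

/-- The number of weakly connected components. -/
noncomputable def numComponents (D : MultiDigraph V) : ℕ :=
  Nat.card D.underlyingGraph.ConnectedComponent

/-- Relabelling of the nodes along a bijection. -/
def relabel (e : V ≃ W) (D : MultiDigraph V) : MultiDigraph W :=
  ⟨D.arcs.map (Prod.map e e)⟩

/-- Two digraphs are isomorphic if one is obtained from the other by relabelling the nodes. -/
def Isomorphic (D : MultiDigraph V) (E : MultiDigraph W) : Prop :=
  ∃ e : V ≃ W, D.relabel e = E

theorem Isomorphic.refl (D : MultiDigraph V) : D.Isomorphic D :=
  ⟨Equiv.refl V, by ext1; simp [relabel]⟩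

theorem Isomorphic.symm {D : MultiDigraph V} {E : MultiDigraph W} (h : D.Isomorphic E) :
    E.Isomorphic D := by
  obtain ⟨e, rfl⟩ := h
  refine ⟨e.symm, ?_⟩
  ext1
  simp [relabel, Multiset.map_map, Prod.map]

theorem Isomorphic.trans {X : Type*} {D : MultiDigraph V} {E : MultiDigraph W}
    {F : MultiDigraph X} (h : D.Isomorphic E) (h' : E.Isomorphic F) : D.Isomorphic F := by
  obtain ⟨e, rfl⟩ := h
  obtain ⟨f, rfl⟩ := h'
  refine ⟨e.trans f, ?_⟩
  ext1
  simp [relabel, Multiset.map_map, Prod.map]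

theorem Isomorphic.numComponents_eq {D : MultiDigraph V} {E : MultiDigraph W}
    (h : D.Isomorphic E) : D.numComponents = E.numComponents := by
  obtain ⟨e, rfl⟩ := h
  have hmem : ∀ u v, (e u, e v) ∈ (D.relabel e).arcs ↔ (u, v) ∈ D.arcs := by
    intro u v
    simp [relabel]
  have φ : D.underlyingGraph ≃g (D.relabel e).underlyingGraph :=
    ⟨e, by intro u v; simp [underlyingGraph, hmem]⟩
  exact Nat.card_congr φ.connectedComponentEquiv

end MultiDigraph

/-- Labeled `k`-regular digraphs on the nodes `0, …, n - 1`. -/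
abbrev LabeledRegularDigraph (k n : ℕ) : Type :=
  {D : MultiDigraph (Fin n) // D.IsRegular k}

/-- Isomorphism as an equivalence relation on labeled `k`-regular digraphs. -/
instance LabeledRegularDigraph.isoSetoid (k n : ℕ) : Setoid (LabeledRegularDigraph k n) where
  r D E := D.1.Isomorphic E.1
  iseqv := ⟨fun D => .refl D.1, fun h => h.symm, fun h h' => h.trans h'⟩

/-- Unlabeled `k`-regular digraphs on `n` nodes: isomorphism classes of labeled ones. -/
abbrev UnlabeledRegularDigraph (k n : ℕ) : Type :=
  Quotient (LabeledRegularDigraph.isoSetoid k n)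

/-- The number of weakly connected components of an unlabeled digraph. -/
noncomputable def UnlabeledRegularDigraph.numComponents {k n : ℕ} :
    UnlabeledRegularDigraph k n → ℕ :=
  Quotient.lift (fun D => D.1.numComponents)
    fun _ _ h => MultiDigraph.Isomorphic.numComponents_eq h

/-- The number `U_k(n)` of unlabeled `k`-regular digraphs on `n` nodes. -/
noncomputable def numUnlabeled (k n : ℕ) : ℕ :=
  Nat.card (UnlabeledRegularDigraph k n)

/-- The number `U_k(n, c)` of unlabeled `k`-regular digraphs on `n` nodes with exactly `c`
weakly connected components. -/
noncomputable def numUnlabeledComponents (k n c : ℕ) : ℕ :=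
  Nat.card {x : UnlabeledRegularDigraph k n // x.numComponents = c}

/-- The `n × n` matrices with nonnegative integer entries all of whose row sums and column sums
are equal to `k`. -/
abbrev RegularMatrix (k n : ℕ) : Type :=
  {A : Matrix (Fin n) (Fin n) ℕ // (∀ i, ∑ j, A i j = k) ∧ ∀ j, ∑ i, A i j = k}

/-- Permutations act by permuting rows and columns simultaneously:
`(σ • A) (σ i) (σ j) = A i j`. -/
instance RegularMatrix.permAction (k n : ℕ) :
    MulAction (Equiv.Perm (Fin n)) (RegularMatrix k n) where
  smul σ A := ⟨A.1.submatrix σ.symm σ.symm, by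
    refine ⟨fun i => ?_, fun j => ?_⟩
    · exact (Equiv.sum_comp σ.symm fun j => A.1 (σ.symm i) j).trans (A.2.1 _)
    · exact (Equiv.sum_comp σ.symm fun i => A.1 i (σ.symm j)).trans (A.2.2 _)⟩
  one_smul _ := rfl
  mul_smul _ _ _ := rfl

/-- Orbits of regular matrices under simultaneous permutations of rows and columns. -/
abbrev RegularMatrixOrbit (k n : ℕ) : Type :=
  MulAction.orbitRel.Quotient (Equiv.Perm (Fin n)) (RegularMatrix k n)

namespace MultiDigraph

theorem sum_adjMatrix_row {n : ℕ} (D : MultiDigraph (Fin n)) (i : Fin n) :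
    ∑ j, D.adjMatrix i j = D.outdegree i := by
  obtain ⟨s⟩ := D
  induction s using Multiset.induction_on with
  | empty => simp [adjMatrix, outdegree]
  | cons a s ih =>
    obtain ⟨u, v⟩ := a
    simp only [adjMatrix, outdegree, Matrix.of_apply, Multiset.count_cons, Multiset.countP_cons,
      Finset.sum_add_distrib] at ih ⊢
    rw [ih]
    by_cases h : u = i
    · simp [h]
    · simp [h, Ne.symm h]

theorem sum_adjMatrix_col {n : ℕ} (D : MultiDigraph (Fin n)) (j : Fin n) :
    ∑ i, D.adjMatrix i j = D.indegree j := by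
  obtain ⟨s⟩ := D
  induction s using Multiset.induction_on with
  | empty => simp [adjMatrix, indegree]
  | cons a s ih =>
    obtain ⟨u, v⟩ := a
    simp only [adjMatrix, indegree, Matrix.of_apply, Multiset.count_cons, Multiset.countP_cons,
      Finset.sum_add_distrib] at ih ⊢
    rw [ih]
    by_cases h : v = j
    · simp [h]
    · simp [h, Ne.symm h]

end MultiDigraph

/-- The adjacency matrix of a labeled `k`-regular digraph, as a matrix with all row and column
sums equal to `k`. -/
def LabeledRegularDigraph.toMatrix {k n : ℕ} (D : LabeledRegularDigraph k n) :
    RegularMatrix k n :=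
  ⟨D.1.adjMatrix, fun i => (D.1.sum_adjMatrix_row i).trans (D.2 i).1,
    fun j => (D.1.sum_adjMatrix_col j).trans (D.2 j).2⟩

/-! Give every node two outgoing and two incoming arc ends. The arcs of a 2-regular digraph match
outgoing with incoming ends, so every such digraph on `Fin n` comes from a permutation π of `Fin n ×
Bool` (`MultiDigraph.exists_ofPerm_eq`). Two permutations give isomorphic digraphs exactly when they
differ by renaming the nodes and by swapping, independently, the two outgoing or the two incoming
ends at some nodes (`MultiDigraph.isomorphic_ofPerm_iff`). This is the action π ↦ gπh⁻¹ of the group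
of pairs (g, h) of lifts of a common node permutation σ, a group of order n!·4ⁿ.

A pair (g, h) fixes π iff gπ = πh. The number of such π is the order of the centralizer of g if g
and h have the same cycle lengths, and 0 otherwise; Burnside's lemma then gives
`numUnlabeled_two_mul`. Over an l-cycle of σ a lift has either two l-cycles or one 2l-cycle, by the
parity of the number of swaps, and each case occurs for 2^(l-1) lifts. So the Burnside sum depends
only on the cycle lengths of σ and becomes a finite sum over partitions of n, which the kernel
evaluates for n ≤ 9.

A digraph is determined by the multiset of its connected components
(`RegularDigraphClass.componentsEquiv`), so all counts are sums over multisets of connected classes.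
Subtracting the disconnected digraphs from the totals yields the connected counts recursively, and
these give the whole table. The orbits of matrices come from the fact that a digraph is determined
by its arc multiplicities. -/

/-- Two functions take every value equally often exactly when they differ by a bijection of their
domains. -/
theorem Multiset.exists_equiv_of_map_univ_eq {α β γ : Type*} [Fintype α] [Fintype β]
    {f : α → γ} {g : β → γ}
    (h : (Finset.univ : Finset α).val.map f = (Finset.univ : Finset β).val.map g) :
    ∃ e : α ≃ β, ∀ x, g (e x) = f x := by
  classical
  have hc : ∀ c, Nonempty ({x // f x = c} ≃ {y // g y = c}) := by
    intro c
    have := congrArg (Multiset.count c) h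
    rw [Multiset.count_map, Multiset.count_map] at this
    refine ⟨Fintype.equivOfCardEq ?_⟩
    rw [Fintype.card_subtype, Fintype.card_subtype, Finset.card_def, Finset.card_def,
      Finset.filter_val, Finset.filter_val]
    simpa only [eq_comm] using this
  have φ := fun c => (hc c).some
  refine ⟨(Equiv.sigmaFiberEquiv f).symm.trans
    ((Equiv.sigmaCongrRight φ).trans (Equiv.sigmaFiberEquiv g)), fun x => ?_⟩
  exact (φ (f x) ⟨x, rfl⟩).2

/-! ### Cycle lengths with fixed points included. -/

namespace Equiv.Perm

open Equiv

/-- The multiset of cycle lengths of a permutation, fixed points included. -/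
def parts {α : Type*} [Fintype α] [DecidableEq α] (σ : Perm α) : Multiset ℕ :=
  σ.partition.parts

variable {α β : Type*} [Fintype α] [DecidableEq α] [Fintype β] [DecidableEq β]

theorem sum_parts (σ : Perm α) : σ.parts.sum = Fintype.card α := σ.partition.parts_sum

theorem parts_eq (σ : Perm α) :
    σ.parts = σ.cycleType + Multiset.replicate (Fintype.card α - σ.cycleType.sum) 1 := by
  rw [parts, parts_partition, sum_cycleType]

theorem isConj_iff_parts_eq {σ τ : Perm α} : IsConj σ τ ↔ σ.parts = τ.parts := by
  rw [partition_eq_of_isConj, Nat.Partition.ext_iff, parts, parts]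

theorem cycleType_permCongr (e : α ≃ β) (σ : Perm α) :
    (e.permCongr σ).cycleType = σ.cycleType := by
  classical
  rw [← cycleType_extendDomain (e.trans (Equiv.Set.univ β).symm : α ≃ (_root_.Set.univ : _root_.Set β))]
  rfl

theorem parts_permCongr (e : α ≃ β) (σ : Perm α) : (e.permCongr σ).parts = σ.parts := by
  rw [parts_eq, parts_eq, cycleType_permCongr, Fintype.card_congr e]

/-- The permutation is a product of two disjoint ones, each acting on one summand and extended by
the identity to the other. -/
theorem cycleType_sumCongr (σ : Perm α) (τ : Perm β) :
    (sumCongr σ τ : Perm (α ⊕ β)).cycleType = σ.cycleType + τ.cycleType := by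
  classical
  have h : (sumCongr σ τ : Perm (α ⊕ β)) = sumCongr σ 1 * sumCongr 1 τ := by
    rw [sumCongr_mul, mul_one, one_mul]
  have hd : Disjoint (sumCongr σ (1 : Perm β)) (sumCongr (1 : Perm α) τ) := by
    rintro (x | x) <;> simp [sumCongr]
  have h1 : (sumCongr σ (1 : Perm β)) =
      σ.extendDomain (Equiv.ofInjective (Sum.inl : α → α ⊕ β) Sum.inl_injective) := by
    ext (x | x)
    · exact (extendDomain_apply_image σ
        (Equiv.ofInjective (Sum.inl : α → α ⊕ β) Sum.inl_injective) x).symm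
    · exact (extendDomain_apply_not_subtype _ _ (by simp)).symm
  have h2 : (sumCongr (1 : Perm α) τ) =
      τ.extendDomain (Equiv.ofInjective (Sum.inr : β → α ⊕ β) Sum.inr_injective) := by
    ext (x | x)
    · exact (extendDomain_apply_not_subtype _ _ (by simp)).symm
    · exact (extendDomain_apply_image τ
        (Equiv.ofInjective (Sum.inr : β → α ⊕ β) Sum.inr_injective) x).symm
  rw [h, hd.cycleType_mul, h1, h2, cycleType_extendDomain, cycleType_extendDomain]

theorem parts_sumCongr (σ : Perm α) (τ : Perm β) :
    (sumCongr σ τ : Perm (α ⊕ β)).parts = σ.parts + τ.parts := by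
  have h1 : σ.cycleType.sum ≤ Fintype.card α := by
    rw [sum_cycleType]; exact Finset.card_le_univ _
  have h2 : τ.cycleType.sum ≤ Fintype.card β := by
    rw [sum_cycleType]; exact Finset.card_le_univ _
  rw [parts_eq, parts_eq, parts_eq, cycleType_sumCongr, Fintype.card_sum, Multiset.sum_add,
    show Fintype.card α + Fintype.card β - (σ.cycleType.sum + τ.cycleType.sum) =
      (Fintype.card α - σ.cycleType.sum) + (Fintype.card β - τ.cycleType.sum) by omega,
    Multiset.replicate_add]
  abel

theorem parts_finRotate (n : ℕ) : (finRotate (n + 1)).parts = {n + 1} := by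
  rw [parts_eq]
  cases n with
  | zero => simp [Subsingleton.elim (finRotate 1) 1]
  | succ n => rw [cycleType_finRotate]; simp

end Equiv.Perm

/-! ### Centralizers, conjugacy classes and sums over permutations. -/

/-- The order of the centralizer of a permutation with the given cycle lengths. -/
def Multiset.centralizerCard (s : Multiset ℕ) : ℕ :=
  s.prod * ∏ n ∈ s.toFinset, (s.count n).factorial

theorem Multiset.prod_count_factorial_cons (a : ℕ) (s : Multiset ℕ) :
    ∏ n ∈ (a ::ₘ s).toFinset, ((a ::ₘ s).count n).factorial =
      (s.count a + 1) * ∏ n ∈ s.toFinset, (s.count n).factorial := by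
  have h : ∏ n ∈ s.toFinset, (s.count n).factorial =
      ∏ n ∈ (a ::ₘ s).toFinset, (s.count n).factorial := by
    refine Finset.prod_subset (by simp) fun x _ hx => ?_
    rw [Multiset.count_eq_zero_of_notMem (by simpa using hx), Nat.factorial_zero]
  have ha : a ∈ (a ::ₘ s).toFinset := by simp
  rw [h, ← Finset.mul_prod_erase _ _ ha, ← Finset.mul_prod_erase _ _ ha, ← mul_assoc,
    Multiset.count_cons_self, Nat.factorial_succ]
  congr 1
  refine Finset.prod_congr rfl fun x hx => ?_
  rw [Multiset.count_cons_of_ne (Finset.ne_of_mem_erase hx)]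

theorem Multiset.centralizerCard_cons (a : ℕ) (s : Multiset ℕ) :
    (a ::ₘ s).centralizerCard = a * (s.count a + 1) * s.centralizerCard := by
  rw [centralizerCard, prod_count_factorial_cons, Multiset.prod_cons, centralizerCard]
  ring

/-- Cycle types omit fixed points. This reconciles `centralizerCard`, where the part 1 is treated
like any other, with the centralizer formula in which fixed points contribute a separate factorial.
-/
theorem Multiset.centralizerCard_add_replicate {s : Multiset ℕ} (hs : 1 ∉ s) (m : ℕ) :
    (s + Multiset.replicate m 1).centralizerCard =
      m.factorial * s.prod * ∏ n ∈ s.toFinset, (s.count n).factorial := by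
  induction m with
  | zero => simp [centralizerCard]
  | succ m ih =>
    rw [Multiset.replicate_succ, Multiset.add_cons, centralizerCard_cons, ih, Multiset.count_add,
      Multiset.count_replicate_self, Multiset.count_eq_zero_of_notMem hs, Nat.factorial_succ]
    ring

namespace Equiv.Perm

open Equiv

variable {α : Type*} [Fintype α] [DecidableEq α]

theorem centralizerCard_parts (σ : Perm α) :
    σ.parts.centralizerCard = (Fintype.card α - σ.cycleType.sum).factorial * σ.cycleType.prod *
      ∏ n ∈ σ.cycleType.toFinset, (σ.cycleType.count n).factorial := by
  rw [parts_eq, Multiset.centralizerCard_add_replicate]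
  intro h
  exact absurd (two_le_of_mem_cycleType h) (by norm_num)

/-- The number of permutations intertwining two given ones. -/
theorem card_intertwining (g h : Perm α) :
    Fintype.card {π : Perm α // g * π = π * h} =
      if g.parts = h.parts then g.parts.centralizerCard else 0 := by
  classical
  split_ifs with hp
  · rw [← isConj_iff_parts_eq, isConj_iff] at hp
    obtain ⟨c, rfl⟩ := hp
    rw [centralizerCard_parts, ← nat_card_centralizer, ← Nat.card_eq_fintype_card]
    -- Here h = c g c⁻¹, so π ↦ πc carries the intertwining permutations onto the centralizer of g.
    refine Nat.card_congr ⟨fun π => ⟨π.1 * c, ?_⟩, fun π => ⟨π.1 * c⁻¹, ?_⟩, fun π => ?_,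
      fun π => ?_⟩
    · rw [Subgroup.mem_centralizer_singleton_iff, ← mul_assoc, π.2]
      group
    · have := Subgroup.mem_centralizer_singleton_iff.1 π.2
      rw [← mul_assoc, ← this]
      group
    · simp
    · simp
  · rw [Fintype.card_eq_zero_iff]
    refine ⟨fun π => hp ?_⟩
    rw [← isConj_iff_parts_eq, isConj_comm, isConj_iff]
    exact ⟨π.1, by rw [← π.2, mul_inv_cancel_right]⟩

/-- The size of a conjugacy class of permutations. -/
theorem card_parts_eq_mul (σ : Perm α) :
    (Finset.univ.filter fun τ : Perm α => τ.parts = σ.parts).card * σ.parts.centralizerCard =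
      (Fintype.card α).factorial := by
  classical
  rw [centralizerCard_parts, ← card_isConj_mul_eq σ, Nat.card_eq_fintype_card,
    ← Set.toFinset_card]
  congr 2
  ext τ
  rw [Finset.mem_filter, Set.mem_toFinset, Set.mem_ofPred_eq, isConj_iff_parts_eq]
  simp [eq_comm]

/-- A sum over permutations of a function of the cycle lengths is a sum over partitions. -/
theorem sum_parts_eq_sum_partitions {n : ℕ} (S : Finset (Multiset ℕ))
    (hS : ∀ s : Multiset ℕ, s ∈ S ↔ (∀ x ∈ s, 1 ≤ x) ∧ s.sum = n) (F : Multiset ℕ → ℕ) :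
    ∑ σ : Perm (Fin n), F σ.parts = ∑ s ∈ S, n.factorial / s.centralizerCard * F s := by
  have hm : ∀ σ ∈ (Finset.univ : Finset (Perm (Fin n))), σ.parts ∈ S := fun σ _ =>
    (hS _).2 ⟨fun x hx => σ.partition.parts_pos hx, by rw [sum_parts, Fintype.card_fin]⟩
  rw [← Finset.sum_fiberwise_of_maps_to hm]
  refine Finset.sum_congr rfl fun s hs => ?_
  rw [Finset.sum_congr rfl (g := fun _ => F s) (by simp +contextual), Finset.sum_const,
    smul_eq_mul]
  congr 1
  obtain ⟨h1, h2⟩ := (hS s).1 hs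
  -- A permutation with cycle lengths `s` is obtained by prescribing the parts that are at least 2;
  -- the remaining parts are ones and become fixed points.
  obtain ⟨σ, hσ⟩ := (exists_with_cycleType_iff (Fin n) (m := s.filter (2 ≤ ·))).2
    ⟨by rw [Fintype.card_fin, ← h2]
        conv_rhs => rw [← Multiset.filter_add_not (2 ≤ ·) s, Multiset.sum_add]
        exact Nat.le_add_right _ _, by simp⟩
  have hσs : σ.parts = s := by
    have hr : s.filter (fun x => ¬ 2 ≤ x) =
        Multiset.replicate (s.filter (fun x => ¬ 2 ≤ x)).card 1 := by
      rw [Multiset.eq_replicate]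
      refine ⟨rfl, fun b hb => ?_⟩
      obtain ⟨hb, hb'⟩ := Multiset.mem_filter.1 hb
      have := h1 b hb
      omega
    have hs := Multiset.filter_add_not (2 ≤ ·) s
    rw [hr] at hs
    rw [parts_eq, hσ, Fintype.card_fin]
    conv_rhs => rw [← hs]
    congr 2
    have := congrArg Multiset.sum hs
    rw [Multiset.sum_add, h2, Multiset.sum_replicate] at this
    simp only [smul_eq_mul, mul_one] at this
    omega
  subst hσs
  have := card_parts_eq_mul σ
  rw [Fintype.card_fin] at this
  rw [← this, Nat.mul_div_cancel]
  rw [centralizerCard_parts, ← nat_card_centralizer]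
  exact Nat.card_pos

end Equiv.Perm

/-! ### Lifts of a permutation to the two-sheeted cover. -/

namespace Equiv.Perm

open Equiv

/-- The lift of a permutation `σ` of `α` to the two-sheeted cover `α × Bool` that exchanges the
sheets over the points where `ε` is true. -/
def doubleLift {α : Type*} (σ : Perm α) (ε : α → Bool) : Perm (α × Bool) where
  toFun x := (σ x.1, xor x.2 (ε x.1))
  invFun x := (σ.symm x.1, xor x.2 (ε (σ.symm x.1)))
  left_inv x := by simp
  right_inv x := by simp

@[simp]
theorem doubleLift_apply {α : Type*} (σ : Perm α) (ε : α → Bool) (x : α × Bool) :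
    doubleLift σ ε x = (σ x.1, xor x.2 (ε x.1)) := rfl

variable {α β : Type*} [Fintype α] [DecidableEq α] [Fintype β] [DecidableEq β]

/-- Lifts differing by a change of trivialization of the cover have the same cycle lengths. -/
theorem parts_doubleLift_gauge (σ : Perm α) (ε s : α → Bool) :
    (doubleLift σ fun a => xor (ε a) (xor (s a) (s (σ a)))).parts = (doubleLift σ ε).parts := by
  -- The change of trivialization is conjugation by the lift of the identity that swaps the sheets
  -- where `s` is true.
  rw [← parts_permCongr (doubleLift 1 s) (doubleLift σ ε)]
  congr 1
  refine Equiv.ext fun x => ?_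
  obtain ⟨y, rfl⟩ := (doubleLift 1 s).surjective x
  rw [permCongr_apply, symm_apply_apply]
  obtain ⟨a, b⟩ := y
  refine Prod.ext_iff.2 ⟨Eq.refl (σ a), ?_⟩
  simp only [doubleLift_apply, one_apply]
  cases b <;> cases ε a <;> cases s a <;>
    cases s (σ a) <;> rfl

theorem parts_doubleLift_permCongr (e : α ≃ β) (σ : Perm α) (ε : β → Bool) :
    (doubleLift (e.permCongr σ) ε).parts = (doubleLift σ (ε ∘ e)).parts := by
  rw [← parts_permCongr (e.prodCongr (Equiv.refl Bool)) (doubleLift σ (ε ∘ e))]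
  congr 1
  ext x <;> simp

theorem parts_doubleLift_sumCongr (σ : Perm α) (τ : Perm β) (ε : α ⊕ β → Bool) :
    (doubleLift (sumCongr σ τ) ε).parts =
      (doubleLift σ (ε ∘ Sum.inl)).parts + (doubleLift τ (ε ∘ Sum.inr)).parts := by
  rw [← parts_sumCongr, ← parts_permCongr (sumProdDistrib α β Bool).symm]
  congr 1
  ext ⟨x | x, b⟩ <;> simp [permCongr_apply, sumProdDistrib]

theorem parts_doubleLift_false (σ : Perm α) :
    (doubleLift σ fun _ => false).parts = σ.parts + σ.parts := by
  rw [← parts_sumCongr, ← parts_permCongr ((prodComm α Bool).trans (boolProdEquivSum α))]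
  congr 1
  ext (x | x) <;> simp [permCongr_apply]

theorem val_finRotate_succ (n : ℕ) (i : Fin (n + 1)) :
    (finRotate (n + 1) i).val = if i.val = n then 0 else i.val + 1 := by
  rw [coe_finRotate]
  simp only [Fin.ext_iff, Fin.val_last]

/-- One turn around the base changes the sheet exactly once, so only two turns close up. Numbering
one sheet after the other turns the lift into the rotation of `Fin (2 * (n + 1))`. -/
theorem parts_doubleLift_finRotate_last (n : ℕ) :
    (doubleLift (finRotate (n + 1)) fun i => decide (i = Fin.last n)).parts = {2 * (n + 1)} := by
  let e : Fin (n + 1) × Bool ≃ Fin (2 * (n + 1)) :=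
    ((prodComm _ _).trans (finTwoEquiv.symm.prodCongr (Equiv.refl _))).trans finProdFinEquiv
  have he : ∀ i b, (e (i, b)).val = i.val + (n + 1) * (if b then 1 else 0) := by
    rintro i (_ | _) <;> rfl
  rw [← parts_permCongr e]
  refine Eq.trans (congrArg parts ?_) (parts_finRotate (2 * n + 1))
  ext x
  obtain ⟨⟨i, b⟩, rfl⟩ := e.surjective x
  rw [permCongr_apply, symm_apply_apply, doubleLift_apply, he, val_finRotate_succ]
  refine Eq.trans ?_ (val_finRotate_succ (2 * n + 1) (e (i, b))).symm
  rw [he]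
  simp only [Fin.ext_iff, Fin.val_last]
  have := i.isLt
  by_cases hi : i.val = n <;> cases b <;> simp [hi] <;> (try split_ifs) <;> omega

/-- Summing a function of the cycle lengths over all lifts of a cycle. -/
theorem sum_doubleLift_finRotate (n : ℕ) (f : Multiset ℕ → ℕ) :
    ∑ ε : Fin (n + 1) → Bool, f (doubleLift (finRotate (n + 1)) ε).parts =
      2 ^ n * (f {n + 1, n + 1} + f {2 * (n + 1)}) := by
  -- The first n values of `ε` are arbitrary; of the two choices for the last value, one makes the
  -- total number of swaps even and the other odd.
  rw [← (Fin.snocEquiv fun _ => Bool).sum_comp, Fintype.sum_prod_type_right]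
  have key : ∀ ε : Fin n → Bool, ∑ b : Bool,
      f (doubleLift (finRotate (n + 1)) (Fin.snocEquiv (fun _ => Bool) (b, ε))).parts =
        f {n + 1, n + 1} + f {2 * (n + 1)} := by
    intro ε
    -- `S k` is the parity of the swaps over points below k. Used as a change of trivialization, it
    -- moves all swaps to the last point, where only the total parity `xor (S n) b` remains.
    let S : ℕ → Bool := fun k =>
      Nat.rec false (fun k s => xor s (if h : k < n then ε ⟨k, h⟩ else false)) k
    have hS : ∀ k (h : k < n), S (k + 1) = xor (S k) (ε ⟨k, h⟩) := by
      intro k h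
      change xor (S k) (if h : k < n then ε ⟨k, h⟩ else false) = _
      rw [dif_pos h]
    have hp : ∀ b : Bool,
        (doubleLift (finRotate (n + 1)) (Fin.snocEquiv (fun _ => Bool) (b, ε))).parts =
          if xor (S n) b then {2 * (n + 1)} else {n + 1, n + 1} := by
      intro b
      rw [← parts_doubleLift_gauge _ _ fun i => S i.val]
      have hfun : (fun i : Fin (n + 1) => xor (Fin.snocEquiv (fun _ => Bool) (b, ε) i)
          (xor (S i.val) (S (finRotate (n + 1) i).val))) =
          fun i => xor (S n) b && decide (i = Fin.last n) := by
        funext i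
        rw [val_finRotate_succ]
        refine Fin.lastCases ?_ (fun i => ?_) i
        · simp [Fin.snocEquiv, S, Bool.xor_comm]
        · simp [Fin.snocEquiv, i.isLt.ne, hS i.val i.isLt, Fin.ext_iff]
      rw [hfun]
      cases hc : xor (S n) b
      · simp only [Bool.false_and, parts_doubleLift_false, parts_finRotate]
        rfl
      · simpa using parts_doubleLift_finRotate_last n
    simp only [Fintype.sum_bool, hp]
    cases S n <;> simp [add_comm]
  rw [Finset.sum_congr rfl fun ε _ => key ε, Finset.sum_const]
  simp

/-- The sum of `f` over the cycle lengths of all lifts of a permutation with the given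
cycle lengths. -/
def sumLifts : List ℕ → (Multiset ℕ → ℕ) → ℕ
  | [], f => f 0
  | l :: L, f => 2 ^ (l - 1) * (sumLifts L (fun s => f ({l, l} + s)) +
      sumLifts L (fun s => f ({2 * l} + s)))

/-- The model is a disjoint sum of standard rotations, over which the choices of swaps are
independent. An arbitrary permutation is reduced to it by conjugation in `sum_parts_doubleLift`. -/
theorem sumLifts_eq_of_model (L : List ℕ) (hL : ∀ l ∈ L, 1 ≤ l) :
    ∃ (V : Type) (_ : Fintype V) (_ : DecidableEq V) (σ : Perm V), σ.parts = L ∧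
      ∀ f : Multiset ℕ → ℕ, ∑ ε : V → Bool, f (doubleLift σ ε).parts = sumLifts L f := by
  induction L with
  | nil =>
    refine ⟨Fin 0, inferInstance, inferInstance, 1, rfl, fun f => ?_⟩
    simp [sumLifts, parts_eq, Subsingleton.elim (doubleLift (1 : Perm (Fin 0)) _) 1]
  | cons l L ih =>
    obtain ⟨V, _, _, σ, hσ, hf⟩ := ih fun x hx => hL x (by simp [hx])
    obtain ⟨n, rfl⟩ := Nat.exists_eq_add_of_le' (hL l (by simp))
    refine ⟨Fin (n + 1) ⊕ V, inferInstance, inferInstance, sumCongr (finRotate (n + 1)) σ, ?_,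
      fun f => ?_⟩
    · rw [parts_sumCongr, parts_finRotate, hσ]
      rfl
    · rw [← (Equiv.sumArrowEquivProdArrow _ _ Bool).symm.sum_comp, Fintype.sum_prod_type_right]
      simp only [parts_doubleLift_sumCongr]
      have : ∀ (ε : Fin (n + 1) → Bool) (δ : V → Bool),
          ((Equiv.sumArrowEquivProdArrow _ _ Bool).symm (ε, δ)) ∘ Sum.inl = ε ∧
          ((Equiv.sumArrowEquivProdArrow _ _ Bool).symm (ε, δ)) ∘ Sum.inr = δ :=
        fun ε δ => ⟨rfl, rfl⟩
      simp only [this]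
      rw [Finset.sum_congr rfl fun δ _ =>
        sum_doubleLift_finRotate n fun s => f (s + (doubleLift σ δ).parts)]
      rw [← Finset.mul_sum, Finset.sum_add_distrib, hf fun s => f ({n + 1, n + 1} + s),
        hf fun s => f ({2 * (n + 1)} + s)]
      rfl

theorem sum_parts_doubleLift (σ : Perm α) {L : List ℕ} (hL : σ.parts = L)
    (f : Multiset ℕ → ℕ) :
    ∑ ε : α → Bool, f (doubleLift σ ε).parts = sumLifts L f := by
  obtain ⟨V, _, _, τ, hτ, hf⟩ := sumLifts_eq_of_model L fun l hl =>
    σ.partition.parts_pos (show l ∈ σ.parts by rw [hL]; exact hl)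
  have hc : Fintype.card α = Fintype.card V := by rw [← sum_parts σ, ← sum_parts τ, hL, hτ]
  obtain ⟨c, hc⟩ := isConj_iff.1 (isConj_iff_parts_eq.2
    (show ((Fintype.equivOfCardEq hc).symm.permCongr τ).parts = σ.parts by
      rw [parts_permCongr, hτ, hL]))
  rw [← hf f, ← ((((Fintype.equivOfCardEq ‹_›).symm.trans c).arrowCongr
    (Equiv.refl Bool)).sum_comp)]
  refine Finset.sum_congr rfl fun ε _ => ?_
  have hσ : σ = (((Fintype.equivOfCardEq ‹_›).symm.trans c).permCongr τ) := by
    rw [← hc]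
    ext x
    simp [permCongr_apply]
  conv_lhs => rw [hσ, parts_doubleLift_permCongr]
  congr 3
  ext x
  simp

end Equiv.Perm

/-! ### Matchings of arc ends and Burnside's lemma. -/

open Equiv

/-- The pairs of lifts of a common permutation to `α × Bool`. -/
def doubleLiftPairs (α : Type*) : Subgroup (Perm α × Perm (α × Bool) × Perm (α × Bool)) where
  carrier := {γ | ∀ x, (γ.2.1 x).1 = γ.1 x.1 ∧ (γ.2.2 x).1 = γ.1 x.1}
  one_mem' x := ⟨rfl, rfl⟩
  mul_mem' {γ γ'} h h' x := by
    simp only [Prod.snd_mul, Prod.fst_mul, Perm.mul_apply, (h _).1, (h _).2, (h' _).1, (h' _).2,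
      and_self]
  inv_mem' {γ} h x := by
    have h1 := (h (γ.2.1.symm x)).1
    have h2 := (h (γ.2.2.symm x)).2
    rw [apply_symm_apply] at h1 h2
    exact ⟨((symm_apply_eq _).2 h1).symm, ((symm_apply_eq _).2 h2).symm⟩

/-- A permutation of `α × Bool` over a permutation of `α` exchanges the sheets over some of the
points. -/
theorem Equiv.Perm.eq_doubleLift {α : Type*} {σ : Perm α} {g : Perm (α × Bool)}
    (h : ∀ x, (g x).1 = σ x.1) : g = doubleLift σ fun a => (g (a, false)).2 := by
  ext ⟨a, b⟩
  · exact h _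
  · cases b
    · simp
    · have h1 := h (a, true)
      have h2 := h (a, false)
      have h3 : g (a, true) ≠ g (a, false) := by simp
      rw [Perm.doubleLift_apply, Bool.true_xor]
      have h4 : (g (a, true)).2 ≠ (g (a, false)).2 := fun h4 =>
        h3 (Prod.ext (h1.trans h2.symm) h4)
      revert h4
      cases (g (a, true)).2 <;> cases (g (a, false)).2 <;> simp

/-- A pair of lifts of a permutation is determined by the points over which the sheets are
exchanged. -/
def doubleLiftPairsEquiv (α : Type*) :
    Perm α × (α → Bool) × (α → Bool) ≃ doubleLiftPairs α where
  toFun t := ⟨(t.1, Perm.doubleLift t.1 t.2.1, Perm.doubleLift t.1 t.2.2), fun _ => ⟨rfl, rfl⟩⟩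
  invFun γ := (γ.1.1, (fun a => (γ.1.2.1 (a, false)).2), fun a => (γ.1.2.2 (a, false)).2)
  left_inv t := by simp
  right_inv γ := by
    obtain ⟨⟨σ, g, h⟩, hγ⟩ := γ
    exact Subtype.ext (Prod.ext rfl (Prod.ext (Perm.eq_doubleLift fun x => (hγ x).1).symm
      (Perm.eq_doubleLift fun x => (hγ x).2).symm))

/-- Since π sends outgoing ends to incoming ends, the first lift relabels the incoming ends and the
second the outgoing ones. -/
instance doubleLiftPairs.mulAction (α : Type*) :
    MulAction (doubleLiftPairs α) (Perm (α × Bool)) where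
  smul γ π := γ.1.2.1 * π * γ.1.2.2⁻¹
  one_smul π := by
    change 1 * π * 1⁻¹ = π
    simp
  mul_smul γ γ' π := by
    change γ.1.2.1 * γ'.1.2.1 * π * (γ.1.2.2 * γ'.1.2.2)⁻¹ =
      γ.1.2.1 * (γ'.1.2.1 * π * γ'.1.2.2⁻¹) * γ.1.2.2⁻¹
    group

theorem doubleLiftPairs.smul_def {α : Type*} (γ : doubleLiftPairs α) (π : Perm (α × Bool)) :
    γ • π = γ.1.2.1 * π * γ.1.2.2⁻¹ := rfl

namespace MultiDigraph

/-- The digraph obtained from a matching of outgoing with incoming arc ends, two of each at every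
node. -/
def ofPerm {α : Type*} [Fintype α] (π : Perm (α × Bool)) : MultiDigraph α :=
  ⟨Finset.univ.val.map fun x => (x.1, (π x).1)⟩

theorem countP_map_univ_fst {α : Type*} [Fintype α] [DecidableEq α] (v : α) :
    (Finset.univ : Finset (α × Bool)).val.countP (fun x => x.1 = v) = 2 := by
  rw [Multiset.countP_eq_card_filter, ← Finset.filter_val, ← Finset.card_def]
  have : (Finset.univ.filter fun x : α × Bool => x.1 = v) = {v} ×ˢ Finset.univ := by
    ext ⟨a, b⟩; cases b <;> simp
  rw [this]
  simp

theorem isRegular_ofPerm {α : Type*} [Fintype α] [DecidableEq α] (π : Perm (α × Bool)) :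
    (ofPerm π).IsRegular 2 := by
  intro v
  refine ⟨?_, ?_⟩
  · rw [outdegree, ofPerm, Multiset.countP_map, ← Multiset.countP_eq_card_filter]
    exact countP_map_univ_fst v
  · have : (ofPerm π).arcs.map Prod.snd = Finset.univ.val.map fun x : α × Bool => x.1 := by
      rw [ofPerm, Multiset.map_map]
      conv_rhs => rw [← Multiset.map_univ_val_equiv π, Multiset.map_map]
      rfl
    have h := congrArg (Multiset.countP (· = v)) this
    rw [Multiset.countP_map, Multiset.countP_map, ← Multiset.countP_eq_card_filter,
      ← Multiset.countP_eq_card_filter, countP_map_univ_fst] at h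
    exact h

/-- Every node occurs twice among the tails and twice among the heads, so the arcs, counted with
multiplicity, can be indexed by `α × Bool` in two ways, compatibly with tails and with heads. The
transition between the two indexings is π. -/
theorem exists_ofPerm_eq {α : Type*} [Fintype α] [DecidableEq α] {D : MultiDigraph α}
    (hD : D.IsRegular 2) : ∃ π : Perm (α × Bool), ofPerm π = D := by
  have hval : ∀ (s : Multiset α), (∀ v, s.count v = 2) →
      s = (Finset.univ : Finset (α × Bool)).val.map Prod.fst := by
    intro s hs
    ext v
    rw [hs, Multiset.count_map, ← Multiset.countP_eq_card_filter]
    simp_rw [eq_comm (a := v)]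
    exact (countP_map_univ_fst v).symm
  have h1 : D.arcs.map Prod.fst = (Finset.univ : Finset (α × Bool)).val.map Prod.fst := by
    refine hval _ fun v => ?_
    rw [Multiset.count_map, ← Multiset.countP_eq_card_filter]
    simp_rw [eq_comm (a := v)]
    exact (hD v).1
  have h2 : D.arcs.map Prod.snd = (Finset.univ : Finset (α × Bool)).val.map Prod.fst := by
    refine hval _ fun v => ?_
    rw [Multiset.count_map, ← Multiset.countP_eq_card_filter]
    simp_rw [eq_comm (a := v)]
    exact (hD v).2
  rw [← Multiset.map_univ_comp_coe] at h1 h2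
  obtain ⟨e, he⟩ := Multiset.exists_equiv_of_map_univ_eq h1
  obtain ⟨f, hf⟩ := Multiset.exists_equiv_of_map_univ_eq h2
  refine ⟨e.symm.trans f, ?_⟩
  ext1
  rw [ofPerm, ← Multiset.map_univ_val_equiv e, Multiset.map_map]
  conv_rhs => rw [← Multiset.map_univ_coe D.arcs]
  refine Multiset.map_congr rfl fun x _ => ?_
  simp only [Function.comp_apply, trans_apply, symm_apply_apply]
  exact Prod.ext (he x) (hf x)

theorem isomorphic_ofPerm_iff {α : Type*} [Fintype α] (π π' : Perm (α × Bool)) :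
    (ofPerm π).Isomorphic (ofPerm π') ↔ ∃ γ : doubleLiftPairs α, γ • π = π' := by
  constructor
  · rintro ⟨σ, h⟩
    have h' := congrArg arcs h
    rw [relabel, ofPerm, ofPerm, Multiset.map_map] at h'
    obtain ⟨k, hk⟩ := Multiset.exists_equiv_of_map_univ_eq h'
    simp only [Function.comp_apply, Prod.map_apply, Prod.mk.injEq] at hk
    -- Equality of the arc multisets supplies a bijection `k` of outgoing ends over `σ`; the lift on
    -- incoming ends is then forced by gπk⁻¹ = π'.
    refine ⟨⟨(σ, π' * k * π⁻¹, k), fun x => ⟨?_, (hk x).1⟩⟩, ?_⟩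
    · have := (hk (π⁻¹ x)).2
      simpa using this
    · rw [doubleLiftPairs.smul_def]
      group
  · rintro ⟨⟨⟨σ, g, k⟩, hγ⟩, rfl⟩
    refine ⟨σ, ?_⟩
    ext1
    rw [relabel, ofPerm, ofPerm, Multiset.map_map]
    conv_rhs => rw [← Multiset.map_univ_val_equiv k, Multiset.map_map]
    refine Multiset.map_congr rfl fun x _ => ?_
    refine Prod.ext (hγ x).2.symm ((hγ (π x)).1.symm.trans ?_)
    change (g (π x)).1 = (g (π (k.symm (k x)))).1
    rw [symm_apply_apply]

end MultiDigraph

/-- The unlabeled `2`-regular digraphs are the orbits of the matchings of arc ends. -/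
theorem card_orbits_doubleLiftPairs (n : ℕ) :
    Nat.card (MulAction.orbitRel.Quotient (doubleLiftPairs (Fin n)) (Perm (Fin n × Bool))) =
      numUnlabeled 2 n := by
  refine Nat.card_congr (Equiv.ofBijective (Quotient.map'
    (fun π => (⟨.ofPerm π, MultiDigraph.isRegular_ofPerm π⟩ : LabeledRegularDigraph 2 n))
    fun π π' h => ?_) ⟨?_, ?_⟩)
  · obtain ⟨γ, hγ⟩ := h
    exact MultiDigraph.Isomorphic.symm ((MultiDigraph.isomorphic_ofPerm_iff π' π).2 ⟨γ, hγ⟩)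
  · rintro ⟨π⟩ ⟨π'⟩ h
    obtain ⟨γ, hγ⟩ := (MultiDigraph.isomorphic_ofPerm_iff π' π).1
      (MultiDigraph.Isomorphic.symm (Quotient.exact h))
    exact Quotient.sound ⟨γ, hγ⟩
  · rintro ⟨D, hD⟩
    obtain ⟨π, rfl⟩ := MultiDigraph.exists_ofPerm_eq hD
    exact ⟨Quotient.mk _ π, rfl⟩

/-- Burnside's lemma for `2`-regular digraphs. -/
theorem numUnlabeled_two_mul (n : ℕ) :
    numUnlabeled 2 n * (n.factorial * 4 ^ n) =
      ∑ σ : Perm (Fin n), ∑ ε : Fin n → Bool, ∑ δ : Fin n → Bool,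
        if (Perm.doubleLift σ ε).parts = (Perm.doubleLift σ δ).parts then
          (Perm.doubleLift σ ε).parts.centralizerCard else 0 := by
  classical
  have hG : Fintype.card (doubleLiftPairs (Fin n)) = n.factorial * 4 ^ n := by
    rw [← Fintype.card_congr (doubleLiftPairsEquiv (Fin n)), Fintype.card_prod, Fintype.card_prod,
      Fintype.card_perm, Fintype.card_fun, Fintype.card_fin, Fintype.card_bool, ← mul_pow]
    norm_num
  rw [← card_orbits_doubleLiftPairs, Nat.card_eq_fintype_card, ← hG,
    ← MulAction.sum_card_fixedBy_eq_card_orbits_mul_card_group,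
    ← (doubleLiftPairsEquiv (Fin n)).sum_comp, Fintype.sum_prod_type]
  refine Finset.sum_congr rfl fun σ _ => ?_
  rw [Fintype.sum_prod_type]
  refine Finset.sum_congr rfl fun ε _ => Finset.sum_congr rfl fun δ _ => ?_
  -- The equation gπh⁻¹ = π of a fixed point is the intertwining relation gπ = πh.
  rw [← Perm.card_intertwining]
  refine Fintype.card_congr (Equiv.subtypeEquivRight fun π => ?_)
  rw [MulAction.mem_fixedBy, doubleLiftPairs.smul_def, mul_inv_eq_iff_eq_mul]
  rfl

/-! ### Arc multiplicities, induced subdigraphs and components. -/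

namespace MultiDigraph

variable {V W : Type*} [Fintype V] [DecidableEq V] [Fintype W] [DecidableEq W]

/-- The digraph with prescribed numbers of arcs. -/
def ofCount (A : V → V → ℕ) : MultiDigraph V :=
  ⟨∑ p : V × V, Multiset.replicate (A p.1 p.2) p⟩

@[simp]
theorem count_ofCount (A : V → V → ℕ) (u v : V) : (ofCount A).arcs.count (u, v) = A u v := by
  rw [ofCount, Multiset.count_sum', Finset.sum_eq_single (u, v)]
  · exact Multiset.count_replicate_self _ _
  · intro p _ hp
    rw [Multiset.count_replicate, if_neg hp]
  · simp

omit [Fintype V] in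
theorem ext_count {D E : MultiDigraph V}
    (h : ∀ u v, D.arcs.count (u, v) = E.arcs.count (u, v)) : D = E := by
  ext1
  ext ⟨u, v⟩
  exact h u v

omit [Fintype V] [Fintype W] in
theorem count_relabel (e : V ≃ W) (D : MultiDigraph V) (u v : V) :
    (D.relabel e).arcs.count (e u, e v) = D.arcs.count (u, v) :=
  Multiset.count_map_eq_count' (Prod.map e e) _ (e.injective.prodMap e.injective) (u, v)

omit [Fintype V] [Fintype W] in
theorem isomorphic_iff_count {D : MultiDigraph V} {E : MultiDigraph W} :
    D.Isomorphic E ↔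
      ∃ e : V ≃ W, ∀ u v, E.arcs.count (e u, e v) = D.arcs.count (u, v) := by
  constructor
  · rintro ⟨e, rfl⟩
    exact ⟨e, count_relabel e D⟩
  · rintro ⟨e, he⟩
    refine ⟨e, ext_count fun u v => ?_⟩
    obtain ⟨u, rfl⟩ := e.surjective u
    obtain ⟨v, rfl⟩ := e.surjective v
    rw [count_relabel, he]

theorem outdegree_eq_sum (D : MultiDigraph V) (v : V) :
    D.outdegree v = ∑ u, D.arcs.count (v, u) := by
  obtain ⟨s⟩ := D
  induction s using Multiset.induction_on with
  | empty => simp [outdegree]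
  | cons a s ih =>
    obtain ⟨x, y⟩ := a
    simp only [outdegree, Multiset.count_cons, Multiset.countP_cons,
      Finset.sum_add_distrib] at ih ⊢
    rw [ih]
    by_cases h : x = v
    · simp [h]
    · simp [h, Ne.symm h]

theorem indegree_eq_sum (D : MultiDigraph V) (v : V) :
    D.indegree v = ∑ u, D.arcs.count (u, v) := by
  obtain ⟨s⟩ := D
  induction s using Multiset.induction_on with
  | empty => simp [indegree]
  | cons a s ih =>
    obtain ⟨x, y⟩ := a
    simp only [indegree, Multiset.count_cons, Multiset.countP_cons,
      Finset.sum_add_distrib] at ih ⊢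
    rw [ih]
    by_cases h : y = v
    · simp [h]
    · simp [h, Ne.symm h]

theorem isRegular_iff_count {D : MultiDigraph V} {k : ℕ} :
    D.IsRegular k ↔ ∀ v, ∑ u, D.arcs.count (v, u) = k ∧ ∑ u, D.arcs.count (u, v) = k := by
  simp only [IsRegular, outdegree_eq_sum, indegree_eq_sum]

theorem Isomorphic.isRegular {D : MultiDigraph V} {E : MultiDigraph W} {k : ℕ}
    (h : D.Isomorphic E) (hD : D.IsRegular k) : E.IsRegular k := by
  obtain ⟨e, he⟩ := isomorphic_iff_count.1 h
  rw [isRegular_iff_count] at hD ⊢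
  intro v
  obtain ⟨v, rfl⟩ := e.surjective v
  rw [← e.sum_comp, ← e.sum_comp]
  simpa only [he] using hD v

/-- The subdigraph induced on the nodes that satisfy `p`. -/
def restrict (D : MultiDigraph V) (p : V → Prop) [DecidablePred p] : MultiDigraph {v // p v} :=
  ofCount fun u v => D.arcs.count (u.1, v.1)

@[simp]
theorem count_restrict (D : MultiDigraph V) (p : V → Prop) [DecidablePred p] (u v : {v // p v}) :
    (D.restrict p).arcs.count (u, v) = D.arcs.count (u.1, v.1) := by
  rw [restrict, count_ofCount]

/-- The isomorphism of induced subdigraphs obtained from an isomorphism of digraphs. -/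
theorem isomorphic_restrict {D : MultiDigraph V} {E : MultiDigraph W} (e : V ≃ W)
    (he : ∀ u v, E.arcs.count (e u, e v) = D.arcs.count (u, v)) (p : V → Prop)
    [DecidablePred p] (q : W → Prop) [DecidablePred q] (hpq : ∀ v, p v ↔ q (e v)) :
    (D.restrict p).Isomorphic (E.restrict q) := by
  rw [isomorphic_iff_count]
  refine ⟨e.subtypeEquiv hpq, fun u v => ?_⟩
  rw [count_restrict, count_restrict]
  exact he _ _

omit [Fintype V] [DecidableEq V] in
theorem underlyingGraph_adj (D : MultiDigraph V) (u v : V) :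
    D.underlyingGraph.Adj u v ↔ u ≠ v ∧ ((u, v) ∈ D.arcs ∨ (v, u) ∈ D.arcs) := by
  rw [underlyingGraph, SimpleGraph.fromRel_adj]

theorem underlyingGraph_restrict (D : MultiDigraph V) (p : V → Prop) [DecidablePred p] :
    (D.restrict p).underlyingGraph = D.underlyingGraph.induce {v | p v} := by
  ext u v
  rw [underlyingGraph_adj, SimpleGraph.comap_adj, underlyingGraph_adj, ← Multiset.count_ne_zero,
    ← Multiset.count_ne_zero, count_restrict, count_restrict, Multiset.count_ne_zero,
    Multiset.count_ne_zero]
  simp [Subtype.ext_iff]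

/-- A labeling of the nodes that is constant along the arcs. -/
def IsLocallyConstant {ι : Type*} (D : MultiDigraph V) (κ : V → ι) : Prop :=
  ∀ u v, (u, v) ∈ D.arcs → κ u = κ v

variable {ι ι' : Type*} [DecidableEq ι] [DecidableEq ι'] {D : MultiDigraph V} {κ : V → ι}

omit [DecidableEq ι] [Fintype V] in
theorem IsLocallyConstant.count_eq_zero (h : D.IsLocallyConstant κ) {u v : V} (huv : κ u ≠ κ v) :
    D.arcs.count (u, v) = 0 :=
  Multiset.count_eq_zero_of_notMem fun hm => huv (h u v hm)

omit [DecidableEq V] in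
theorem sum_fiber_eq (f : V → ℕ) (i : ι) (h : ∀ u, κ u ≠ i → f u = 0) :
    ∑ u : {u // κ u = i}, f u.1 = ∑ u, f u := by
  rw [← Finset.sum_subtype (Finset.univ.filter fun u => κ u = i) (by simp) f,
    Finset.sum_filter_of_ne]
  intro u _ hu
  by_contra hne
  exact hu (h u hne)

/-- No arc leaves a fiber of `κ`, so passing to the fiber of a node changes neither of its degrees.
-/
theorem IsLocallyConstant.isRegular_iff (h : D.IsLocallyConstant κ) {k : ℕ} :
    D.IsRegular k ↔ ∀ i, (D.restrict (κ · = i)).IsRegular k := by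
  have key : ∀ v : V, (∑ u : {u // κ u = κ v}, D.arcs.count (v, u.1) = ∑ u, D.arcs.count (v, u)) ∧
      ∑ u : {u // κ u = κ v}, D.arcs.count (u.1, v) = ∑ u, D.arcs.count (u, v) := fun v =>
    ⟨sum_fiber_eq (fun u => D.arcs.count (v, u)) _ fun u hu => h.count_eq_zero (Ne.symm hu),
      sum_fiber_eq (fun u => D.arcs.count (u, v)) _ fun u hu => h.count_eq_zero hu⟩
  simp only [isRegular_iff_count, count_restrict]
  constructor
  · rintro hD _ ⟨v, rfl⟩
    rw [(key v).1, (key v).2]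
    exact hD v
  · intro hD v
    rw [← (key v).1, ← (key v).2]
    exact hD (κ v) ⟨v, rfl⟩

/-- Digraphs with isomorphic parts are isomorphic. -/
theorem IsLocallyConstant.isomorphic {E : MultiDigraph W} {κ' : W → ι'}
    (h : D.IsLocallyConstant κ) (h' : E.IsLocallyConstant κ') (ψ : ι ≃ ι')
    (hψ : ∀ i, (D.restrict (κ · = i)).Isomorphic (E.restrict (κ' · = ψ i))) :
    D.Isomorphic E := by
  simp only [isomorphic_iff_count, count_restrict] at hψ ⊢
  choose φ hφ using hψ
  let e : V ≃ W := (Equiv.sigmaFiberEquiv κ).symm.trans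
    ((ψ.sigmaCongr φ).trans (Equiv.sigmaFiberEquiv κ'))
  have he : ∀ i (v : {v // κ v = i}), e v.1 = (φ i v).1 := by
    rintro _ ⟨v, rfl⟩
    rfl
  have hκ : ∀ v, κ' (e v) = ψ (κ v) := fun v => (φ (κ v) ⟨v, rfl⟩).2
  refine ⟨e, fun u v => ?_⟩
  by_cases huv : κ u = κ v
  · rw [he (κ v) ⟨u, huv⟩, he (κ v) ⟨v, rfl⟩]
    exact hφ (κ v) ⟨u, huv⟩ ⟨v, rfl⟩
  · rw [h.count_eq_zero huv, h'.count_eq_zero]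
    rw [hκ, hκ]
    exact fun h => huv (ψ.injective h)

omit [Fintype V] [DecidableEq V] in
theorem isLocallyConstant_connectedComponentMk (D : MultiDigraph V) :
    D.IsLocallyConstant D.underlyingGraph.connectedComponentMk := by
  intro u v huv
  by_cases h : u = v
  · rw [h]
  · exact SimpleGraph.ConnectedComponent.sound
      (((underlyingGraph_adj D u v).2 ⟨h, Or.inl huv⟩).reachable)

omit [Fintype V] [DecidableEq V] in
theorem numComponents_eq_one_iff (D : MultiDigraph V) :
    D.numComponents = 1 ↔ D.underlyingGraph.Connected := by
  rw [numComponents, Nat.card_eq_one_iff_unique, SimpleGraph.connected_iff]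
  constructor
  · rintro ⟨h1, ⟨c⟩⟩
    exact ⟨fun u v => SimpleGraph.ConnectedComponent.exact (Subsingleton.elim _ _), ⟨c.out⟩⟩
  · rintro ⟨h1, ⟨v⟩⟩
    exact ⟨h1.subsingleton_connectedComponent, ⟨D.underlyingGraph.connectedComponentMk v⟩⟩

open Classical in
theorem numComponents_restrict_component (D : MultiDigraph V)
    (C : D.underlyingGraph.ConnectedComponent) :
    (D.restrict (D.underlyingGraph.connectedComponentMk · = C)).numComponents = 1 := by
  rw [numComponents_eq_one_iff, underlyingGraph_restrict]
  exact C.connected_toSimpleGraph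

/-- A locally constant labeling with connected fibers identifies the components. -/
theorem IsLocallyConstant.exists_equiv (h : D.IsLocallyConstant κ)
    (hc : ∀ i, (D.restrict (κ · = i)).numComponents = 1) :
    ∃ ψ : D.underlyingGraph.ConnectedComponent ≃ ι,
      ∀ v, ψ (D.underlyingGraph.connectedComponentMk v) = κ v := by
  simp only [numComponents_eq_one_iff, underlyingGraph_restrict] at hc
  have hadj : ∀ u v, D.underlyingGraph.Adj u v → κ u = κ v := by
    intro u v huv
    rcases ((underlyingGraph_adj D u v).1 huv).2 with h1 | h1
    · exact h _ _ h1
    · exact (h _ _ h1).symm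
  have hr : ∀ u v, D.underlyingGraph.Reachable u v → κ u = κ v := by
    rintro u v ⟨p⟩
    induction p with
    | nil => rfl
    | cons ha _ ih => exact (hadj _ _ ha).trans ih
  -- The labeling is constant on components. Connectedness of the fibers gives injectivity, and
  -- their nonemptiness gives surjectivity.
  refine ⟨Equiv.ofBijective (fun C => C.lift κ fun u v p _ => hr u v ⟨p⟩) ⟨?_, ?_⟩, fun v => rfl⟩
  · intro C C' hCC
    induction C using SimpleGraph.ConnectedComponent.ind with | _ u
    induction C' using SimpleGraph.ConnectedComponent.ind with | _ v
    have huv : κ u = κ v := hCC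
    exact SimpleGraph.ConnectedComponent.sound
      (((hc (κ v)).preconnected ⟨u, huv⟩ ⟨v, rfl⟩).map (SimpleGraph.Embedding.induce _).toHom)
  · intro i
    obtain ⟨⟨v, hv⟩⟩ := (hc i).nonempty
    exact ⟨D.underlyingGraph.connectedComponentMk v, hv⟩

/-- The disjoint union of a family of digraphs. -/
def sigma {ι : Type*} [Fintype ι] [DecidableEq ι] {m : ι → ℕ}
    (E : ∀ i, MultiDigraph (Fin (m i))) : MultiDigraph (Σ i, Fin (m i)) :=
  ofCount fun x y => if h : x.1 = y.1 then (E y.1).arcs.count (h ▸ x.2, y.2) else 0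

theorem isLocallyConstant_sigma {ι : Type*} [Fintype ι] [DecidableEq ι] {m : ι → ℕ}
    (E : ∀ i, MultiDigraph (Fin (m i))) : (sigma E).IsLocallyConstant Sigma.fst := by
  intro x y hxy
  by_contra h
  rw [← Multiset.count_ne_zero, sigma, count_ofCount, dif_neg h] at hxy
  exact hxy rfl

theorem isomorphic_restrict_sigma {ι : Type*} [Fintype ι] [DecidableEq ι] {m : ι → ℕ}
    (E : ∀ i, MultiDigraph (Fin (m i))) (i : ι) :
    (E i).Isomorphic ((sigma E).restrict (Sigma.fst · = i)) := by
  rw [isomorphic_iff_count]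
  refine ⟨Equiv.ofBijective (fun a => ⟨⟨i, a⟩, rfl⟩) ⟨?_, ?_⟩, fun u v => ?_⟩
  · intro a b hab
    simpa using hab
  · rintro ⟨⟨_, a⟩, rfl⟩
    exact ⟨a, rfl⟩
  · rw [count_restrict, sigma, count_ofCount]
    exact dif_pos rfl

end MultiDigraph

/-! ### Isomorphism classes of all sizes as multisets of connected classes. -/

/-- Isomorphism of labeled `k`-regular digraphs with any number of nodes. -/
instance regularDigraphSetoid (k : ℕ) : Setoid (Σ n, LabeledRegularDigraph k n) where
  r D E := D.2.1.Isomorphic E.2.1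
  iseqv := ⟨fun D => .refl D.2.1, fun h => h.symm, fun h h' => h.trans h'⟩

/-- Isomorphism classes of `k`-regular digraphs. -/
abbrev RegularDigraphClass (k : ℕ) : Type := Quotient (regularDigraphSetoid k)

namespace RegularDigraphClass

variable {k : ℕ}

/-- The number of nodes. -/
def size : RegularDigraphClass k → ℕ :=
  Quotient.lift Sigma.fst fun D E h => by
    obtain ⟨e, -⟩ := h
    simpa using Fintype.card_congr e

/-- The number of components. -/
noncomputable def numComponents : RegularDigraphClass k → ℕ :=
  Quotient.lift (fun D => D.2.1.numComponents) fun _ _ h => h.numComponents_eq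

variable {V W : Type*} [Fintype V] [DecidableEq V] [Fintype W] [DecidableEq W]

/-- The isomorphism class of a digraph. -/
noncomputable def of (D : MultiDigraph V) (hD : D.IsRegular k) : RegularDigraphClass k :=
  Quotient.mk _ ⟨Fintype.card V, D.relabel (Fintype.equivFin V),
    MultiDigraph.Isomorphic.isRegular ⟨_, rfl⟩ hD⟩

theorem of_eq_of_iff {D : MultiDigraph V} {hD : D.IsRegular k} {E : MultiDigraph W}
    {hE : E.IsRegular k} : of D hD = of E hE ↔ D.Isomorphic E := by
  have h1 : D.Isomorphic (D.relabel (Fintype.equivFin V)) := ⟨_, rfl⟩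
  have h2 : E.Isomorphic (E.relabel (Fintype.equivFin W)) := ⟨_, rfl⟩
  constructor
  · intro h
    have h3 : (D.relabel (Fintype.equivFin V)).Isomorphic (E.relabel (Fintype.equivFin W)) :=
      Quotient.exact h
    exact (h1.trans h3).trans h2.symm
  · intro h
    exact Quotient.sound ((h1.symm.trans h).trans h2)

theorem mk_eq_of {n : ℕ} (D : LabeledRegularDigraph k n) :
    (Quotient.mk _ ⟨n, D⟩ : RegularDigraphClass k) = of D.1 D.2 :=
  Quotient.sound ⟨_, rfl⟩

theorem exists_of_eq (q : RegularDigraphClass k) :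
    ∃ (n : ℕ) (D : MultiDigraph (Fin n)) (hD : D.IsRegular k), of D hD = q := by
  obtain ⟨⟨n, D⟩, rfl⟩ := Quotient.exists_rep q
  exact ⟨n, D.1, D.2, (mk_eq_of D).symm⟩

theorem size_of (D : MultiDigraph V) (hD : D.IsRegular k) : (of D hD).size = Fintype.card V := rfl

theorem numComponents_of (D : MultiDigraph V) (hD : D.IsRegular k) :
    (of D hD).numComponents = D.numComponents :=
  MultiDigraph.Isomorphic.numComponents_eq (MultiDigraph.Isomorphic.symm ⟨_, rfl⟩)

/-- Unlabeled digraphs on `n` nodes are the classes of size `n`. -/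
noncomputable def equivUnlabeled (k n : ℕ) :
    UnlabeledRegularDigraph k n ≃ {q : RegularDigraphClass k // q.size = n} :=
  Equiv.ofBijective
    (Quotient.lift (fun D => (⟨Quotient.mk _ ⟨n, D⟩, rfl⟩ :
      {q : RegularDigraphClass k // q.size = n})) fun _ _ h => Subtype.ext (Quotient.sound h))
    ⟨by
      rintro ⟨D⟩ ⟨E⟩ h
      have h1 := Quotient.exact (congrArg Subtype.val h)
      exact Quotient.sound h1, by
      rintro ⟨⟨⟨m, D⟩⟩, rfl⟩
      exact ⟨Quotient.mk _ D, rfl⟩⟩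

theorem numComponents_equivUnlabeled {n : ℕ} (x : UnlabeledRegularDigraph k n) :
    (equivUnlabeled k n x).1.numComponents = UnlabeledRegularDigraph.numComponents x := by
  obtain ⟨D⟩ := x
  rfl

/-- Isomorphism classes of connected digraphs. -/
abbrev Connected (k : ℕ) : Type := {q : RegularDigraphClass k // q.numComponents = 1}

section

open Classical

/-- The class of a component of a digraph. -/
noncomputable def component (D : MultiDigraph V) (hD : D.IsRegular k)
    (C : D.underlyingGraph.ConnectedComponent) : Connected k :=
  ⟨of (D.restrict (D.underlyingGraph.connectedComponentMk · = C))
    ((D.isLocallyConstant_connectedComponentMk.isRegular_iff).1 hD C), by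
    rw [numComponents_of]
    exact D.numComponents_restrict_component C⟩

/-- The classes of the components of a digraph. -/
noncomputable def componentsOf (D : MultiDigraph V) (hD : D.IsRegular k) :
    Multiset (Connected k) :=
  (Finset.univ : Finset D.underlyingGraph.ConnectedComponent).val.map (component D hD)

/-- The components can be read off any locally constant labeling with connected fibers;
connectedness is encoded in the type of `f`. This serves both for invariance under isomorphism and
for disjoint unions. -/
theorem componentsOf_eq {ι : Type*} [Fintype ι] {D : MultiDigraph V} {hD : D.IsRegular k}
    {κ : V → ι} (h : D.IsLocallyConstant κ) (f : ι → Connected k)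
    (hf : ∀ i, (f i).1 = of (D.restrict (κ · = i)) (h.isRegular_iff.1 hD i)) :
    componentsOf D hD = (Finset.univ : Finset ι).val.map f := by
  obtain ⟨ψ, hψ⟩ := h.exists_equiv fun i => by
    rw [← numComponents_of _ (h.isRegular_iff.1 hD i), ← hf i]
    exact (f i).2
  rw [componentsOf, ← Multiset.map_univ_val_equiv ψ, Multiset.map_map]
  refine Multiset.map_congr rfl fun C _ => Subtype.ext ?_
  rw [Function.comp_apply, hf, component, of_eq_of_iff]
  refine MultiDigraph.isomorphic_restrict (Equiv.refl V) (fun _ _ => rfl) _ _ fun v => ?_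
  rw [Equiv.refl_apply, ← hψ, ψ.apply_eq_iff_eq]

theorem componentsOf_congr {D : MultiDigraph V} {hD : D.IsRegular k} {E : MultiDigraph W}
    {hE : E.IsRegular k} (h : D.Isomorphic E) : componentsOf D hD = componentsOf E hE := by
  obtain ⟨e, he⟩ := MultiDigraph.isomorphic_iff_count.1 h
  -- The nodes of `D` are labeled by the components of their images in `E`.
  have hκ : D.IsLocallyConstant fun v => E.underlyingGraph.connectedComponentMk (e v) := by
    intro u v huv
    refine E.isLocallyConstant_connectedComponentMk _ _ ?_
    rwa [← Multiset.count_ne_zero, he, Multiset.count_ne_zero]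
  refine componentsOf_eq hκ _ fun C => ?_
  rw [component, of_eq_of_iff]
  exact (MultiDigraph.isomorphic_restrict e he _ _ fun v => Iff.rfl).symm

/-- The classes of the components. -/
noncomputable def components : RegularDigraphClass k → Multiset (Connected k) :=
  Quotient.lift (fun D => componentsOf D.2.1 D.2.2) fun _ _ h => componentsOf_congr h

theorem components_of (D : MultiDigraph V) (hD : D.IsRegular k) :
    (of D hD).components = componentsOf D hD :=
  componentsOf_congr (MultiDigraph.Isomorphic.symm ⟨_, rfl⟩)

theorem card_components (q : RegularDigraphClass k) : q.components.card = q.numComponents := by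
  obtain ⟨n, D, hD, rfl⟩ := q.exists_of_eq
  rw [components_of, numComponents_of, componentsOf, Multiset.card_map,
    MultiDigraph.numComponents, Nat.card_eq_fintype_card]
  rfl

theorem sum_size_components (q : RegularDigraphClass k) :
    (q.components.map fun c => c.1.size).sum = q.size := by
  obtain ⟨n, D, hD, rfl⟩ := q.exists_of_eq
  rw [components_of, size_of, componentsOf, Multiset.map_map,
    ← Fintype.card_congr (Equiv.sigmaFiberEquiv D.underlyingGraph.connectedComponentMk),
    Fintype.card_sigma]
  rfl

/-- Equal multisets give a bijection between the components that preserves isomorphism classes, and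
isomorphisms between matched components glue. -/
theorem components_injective : Function.Injective (components (k := k)) := by
  intro q q' h
  obtain ⟨n, D, hD, rfl⟩ := q.exists_of_eq
  obtain ⟨m, E, hE, rfl⟩ := q'.exists_of_eq
  rw [components_of, components_of] at h
  obtain ⟨ψ, hψ⟩ := Multiset.exists_equiv_of_map_univ_eq h
  rw [of_eq_of_iff]
  refine D.isLocallyConstant_connectedComponentMk.isomorphic
    E.isLocallyConstant_connectedComponentMk ψ fun C => ?_
  have h1 := (congrArg Subtype.val (hψ C)).symm
  rw [component, component, of_eq_of_iff] at h1
  exact h1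

/-- A preimage is the disjoint union of representatives, indexed by the occurrences in `s` so that
multiplicities are respected. -/
theorem components_surjective : Function.Surjective (components (k := k)) := by
  intro s
  choose m E hE hq using fun c : s => c.1.1.exists_of_eq
  have hr : ∀ c : s, ((MultiDigraph.sigma E).restrict (Sigma.fst · = c)).IsRegular k :=
    fun c => (MultiDigraph.isomorphic_restrict_sigma E c).isRegular (hE c)
  have hD := (MultiDigraph.isLocallyConstant_sigma E).isRegular_iff.2 hr
  refine ⟨of _ hD, ?_⟩
  rw [components_of, componentsOf_eq (MultiDigraph.isLocallyConstant_sigma E) (fun c : s => c.1),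
    Multiset.map_univ_coe]
  intro c
  rw [← hq c, of_eq_of_iff]
  exact MultiDigraph.isomorphic_restrict_sigma E c

end

/-- A digraph is determined by the multiset of its components. -/
noncomputable def componentsEquiv (k : ℕ) :
    RegularDigraphClass k ≃ Multiset (Connected k) :=
  Equiv.ofBijective components ⟨components_injective, components_surjective⟩

theorem card_connected_size_eq (k m : ℕ) :
    Nat.card {c : Connected k // c.1.size = m} = numUnlabeledComponents k m 1 := by
  refine Nat.card_congr (((Equiv.subtypeSubtypeEquivSubtypeInter _ _).trans
    (Equiv.subtypeEquivRight fun q => And.comm)).trans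
    ((Equiv.subtypeSubtypeEquivSubtypeInter _ _).symm.trans
    ((equivUnlabeled k m).subtypeEquiv fun x => ?_).symm))
  rw [numComponents_equivUnlabeled]

theorem one_le_size (c : Connected k) : 1 ≤ c.1.size := by
  obtain ⟨q, hq⟩ := c
  obtain ⟨n, D, hD, rfl⟩ := q.exists_of_eq
  rw [numComponents_of, MultiDigraph.numComponents_eq_one_iff] at hq
  obtain ⟨v⟩ := hq.nonempty
  rw [size_of]
  exact Fintype.card_pos_iff.2 ⟨v⟩

/-- Unlabeled digraphs with `c` components correspond to multisets of `c` connected ones. -/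
theorem numUnlabeledComponents_eq_card (k n c : ℕ) :
    numUnlabeledComponents k n c = Nat.card {s : Multiset (Connected k) //
      (s.map fun d => d.1.size).sum = n ∧ s.card = c} := by
  refine Nat.card_congr ((((equivUnlabeled k n).subtypeEquiv (q := fun q =>
    q.1.numComponents = c) fun x => ?_).trans
    (Equiv.subtypeSubtypeEquivSubtypeInter (fun q : RegularDigraphClass k => q.size = n)
      fun q => q.numComponents = c)).trans ((componentsEquiv k).subtypeEquiv fun q => ?_))
  · rw [numComponents_equivUnlabeled]
  · change _ ↔ (q.components.map fun d => d.1.size).sum = n ∧ q.components.card = c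
    rw [sum_size_components, card_components]

theorem numUnlabeled_eq_card (k n : ℕ) :
    numUnlabeled k n = Nat.card {s : Multiset (Connected k) //
      (s.map fun d => d.1.size).sum = n} := by
  refine Nat.card_congr ((equivUnlabeled k n).trans ((componentsEquiv k).subtypeEquiv fun q => ?_))
  change _ ↔ (q.components.map fun d => d.1.size).sum = n
  rw [sum_size_components]

end RegularDigraphClass

/-! ### Sums over multisets of prescribed total weight. -/

/-- The sum of `f` over the multisets of weights at most `m` with total weight `n`, weighted with
the number `w l j` of ways to choose `j` objects of weight `l`. -/
def sumMultisets (w : ℕ → ℕ → ℕ) : ℕ → ℕ → (List ℕ → ℕ) → ℕ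
  | 0, n, f => if n = 0 then f [] else 0
  | m + 1, n, f => ((List.range (n + 1)).map fun j =>
      if j * (m + 1) ≤ n then
        w (m + 1) j * sumMultisets w m (n - j * (m + 1)) fun L => f (List.replicate j (m + 1) ++ L)
      else 0).sum

theorem sumMultisets_congr {w w' : ℕ → ℕ → ℕ} (m n : ℕ) (f : List ℕ → ℕ)
    (h : ∀ l j, 1 ≤ l → l ≤ m → w l j = w' l j) :
    sumMultisets w m n f = sumMultisets w' m n f := by
  induction m generalizing n f with
  | zero => rfl
  | succ m ih =>
    simp only [sumMultisets]
    congr 2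
    funext j
    rw [h (m + 1) j (by omega) le_rfl, ih _ _ fun l j hl hm => h l j hl (by omega)]

/-- There are `multichoose` many multisets with `j` elements in a type. -/
theorem exists_finset_multiset_card {K : Type*} (p : K → Prop) [Finite {k // p k}] (j : ℕ) :
    ∃ T : Finset (Multiset K), T.card = (Nat.card {k // p k}).multichoose j ∧
      ∀ s, s ∈ T ↔ (∀ x ∈ s, p x) ∧ s.card = j := by
  classical
  have := Fintype.ofFinite {k // p k}
  refine ⟨(Finset.univ : Finset (Sym {k // p k} j)).map ⟨fun t => t.1.map Subtype.val, ?_⟩, ?_,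
    fun s => ?_⟩
  · exact (Multiset.map_injective Subtype.val_injective).comp Subtype.val_injective
  · rw [Finset.card_map, Finset.card_univ, Sym.card_sym_eq_multichoose, Nat.card_eq_fintype_card]
  · simp only [Finset.mem_map, Finset.mem_univ, true_and, Function.Embedding.coeFn_mk]
    constructor
    · rintro ⟨t, rfl⟩
      refine ⟨fun x hx => ?_, by rw [Multiset.card_map]; exact t.2⟩
      obtain ⟨y, -, rfl⟩ := Multiset.mem_map.1 hx
      exact y.2
    · rintro ⟨hs, rfl⟩
      refine ⟨⟨s.attach.map fun x => ⟨x.1, hs x.1 x.2⟩, by simp⟩, ?_⟩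
      simp only [Multiset.map_map, Function.comp_def]
      exact s.attach_map_val

/-- `sumMultisets` sums over the multisets of objects with total weight `n`. -/
theorem exists_finset_sum_eq_sumMultisets {K : Type*} (wt : K → ℕ)
    (hK : ∀ m, 1 ≤ m → Finite {k // wt k = m}) (m n : ℕ) :
    ∃ S : Finset (Multiset K),
      (∀ s, s ∈ S ↔ (∀ x ∈ s, 1 ≤ wt x ∧ wt x ≤ m) ∧ (s.map wt).sum = n) ∧
      ∀ f : Multiset ℕ → ℕ, ∑ s ∈ S, f (s.map wt) =
        sumMultisets (fun l j => (Nat.card {k // wt k = l}).multichoose j) m n fun L => f L := by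
  classical
  induction m generalizing n with
  | zero =>
    refine ⟨if n = 0 then {0} else ∅, fun s => ?_, fun f => ?_⟩
    · have hs : (∀ x ∈ s, 1 ≤ wt x ∧ wt x ≤ 0) ↔ s = 0 := by
        constructor
        · intro h
          refine Multiset.eq_zero_of_forall_notMem fun x hx => ?_
          have := h x hx
          omega
        · rintro rfl
          simp
      rw [hs]
      split_ifs with h0
      · subst h0
        simp +contextual
      · simp only [Finset.notMem_empty, false_iff, not_and]
        rintro rfl
        simpa using Ne.symm h0
    · rw [sumMultisets]
      split_ifs <;> simp
  | succ m ih =>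
    have := hK (m + 1) (by omega)
    choose S hS hf using fun j => ih (n - j * (m + 1))
    choose T hT hmem using exists_finset_multiset_card (fun k : K => wt k = m + 1)
    -- A multiset is split into its j elements of weight exactly m + 1 and the rest, of weight at
    -- most m. Filtering by weight recovers both pieces, so the splitting is unique.
    let P : Finset (Σ _ : ℕ, Multiset K × Multiset K) :=
      ((Finset.range (n + 1)).filter fun j => j * (m + 1) ≤ n).sigma fun j => T j ×ˢ S j
    have hsumT : ∀ j, ∀ t ∈ T j, t.map wt = Multiset.replicate j (m + 1) := by
      intro j t ht
      obtain ⟨h1, rfl⟩ := (hmem j t).1 ht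
      rw [Multiset.map_congr rfl h1, Multiset.map_const']
    have hP : ∀ x, x ∈ P ↔ (x.1 * (m + 1) ≤ n) ∧ x.2.1 ∈ T x.1 ∧ x.2.2 ∈ S x.1 := by
      intro x
      simp only [P, Finset.mem_sigma, Finset.mem_filter, Finset.mem_range, Finset.mem_product]
      constructor
      · tauto
      · rintro ⟨h1, h2⟩
        exact ⟨⟨by nlinarith, h1⟩, h2⟩
    have hfil : ∀ x ∈ P, (x.2.1 + x.2.2).filter (fun k => wt k = m + 1) = x.2.1 ∧
        (x.2.1 + x.2.2).filter (fun k => ¬ wt k = m + 1) = x.2.2 := by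
      intro x hx
      obtain ⟨-, h1, h2⟩ := (hP x).1 hx
      have h1 := ((hmem _ _).1 h1).1
      have h2 := ((hS _ _).1 h2).1
      have h2' : ∀ k ∈ x.2.2, ¬ wt k = m + 1 := fun k hk => by have := h2 k hk; omega
      rw [Multiset.filter_add, Multiset.filter_add, Multiset.filter_eq_self.2 h1,
        Multiset.filter_eq_nil.2 h2', Multiset.filter_eq_self.2 h2',
        Multiset.filter_eq_nil.2 fun k hk => not_not.2 (h1 k hk)]
      simp
    have hinj : Set.InjOn (fun x : Σ _ : ℕ, Multiset K × Multiset K => x.2.1 + x.2.2) P := by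
      intro x hx y hy hxy
      have h1 := hfil x hx
      have h2 := hfil y hy
      have hxy : x.2.1 + x.2.2 = y.2.1 + y.2.2 := hxy
      rw [hxy] at h1
      have e1 := h1.1.symm.trans h2.1
      have e2 := h1.2.symm.trans h2.2
      have e3 : x.1 = y.1 := by
        rw [← ((hmem _ _).1 ((hP x).1 hx).2.1).2, ← ((hmem _ _).1 ((hP y).1 hy).2.1).2, e1]
      obtain ⟨a, b, c⟩ := x
      obtain ⟨a', b', c'⟩ := y
      simp only at e1 e2 e3
      rw [e1, e2, e3]
    refine ⟨P.image fun x => x.2.1 + x.2.2, fun s => ?_, fun f => ?_⟩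
    · rw [Finset.mem_image]
      constructor
      · rintro ⟨x, hx, rfl⟩
        obtain ⟨h0, h1, h2⟩ := (hP x).1 hx
        have h3 := hsumT _ _ h1
        have h1 := ((hmem _ _).1 h1).1
        obtain ⟨h2, h4⟩ := (hS _ _).1 h2
        refine ⟨fun k hk => ?_, ?_⟩
        · rcases Multiset.mem_add.1 hk with hk | hk
          · have := h1 k hk
            omega
          · have := h2 k hk
            omega
        · rw [Multiset.map_add, Multiset.sum_add, h3, h4, Multiset.sum_replicate, smul_eq_mul]
          omega
      · rintro ⟨h1, h2⟩
        have hT' : s.filter (fun k => wt k = m + 1) ∈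
            T (s.filter (fun k => wt k = m + 1)).card :=
          (hmem _ _).2 ⟨fun k hk => (Multiset.mem_filter.1 hk).2, rfl⟩
        have hadd := Multiset.filter_add_not (fun k => wt k = m + 1) s
        have hsum : (s.filter (fun k => wt k = m + 1)).card * (m + 1) +
            ((s.filter (fun k => ¬ wt k = m + 1)).map wt).sum = n := by
          rw [← h2]
          conv_rhs => rw [← hadd]
          rw [Multiset.map_add, Multiset.sum_add, hsumT _ _ hT', Multiset.sum_replicate,
            smul_eq_mul]
        refine ⟨⟨_, s.filter (fun k => wt k = m + 1), s.filter (fun k => ¬ wt k = m + 1)⟩,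
          (hP _).2 ⟨Nat.le.intro hsum, hT', (hS _ _).2 ⟨fun k hk => ?_,
            Nat.eq_sub_of_add_eq' hsum⟩⟩, hadd⟩
        obtain ⟨hk1, hk2⟩ := Multiset.mem_filter.1 hk
        have := h1 k hk1
        omega
    · rw [Finset.sum_image hinj, Finset.sum_sigma, Finset.sum_filter, sumMultisets,
        ← List.sum_toFinset _ List.nodup_range, List.toFinset_range]
      refine Finset.sum_congr rfl fun j _ => ?_
      split_ifs
      · rw [Finset.sum_product]
        have : ∀ t ∈ T j, ∑ s ∈ S j, f ((t + s).map wt) =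
            sumMultisets (fun l j => (Nat.card {k // wt k = l}).multichoose j) m (n - j * (m + 1))
              fun L => f ↑(List.replicate j (m + 1) ++ L) := by
          intro t ht
          simp only [Multiset.map_add, hsumT j t ht]
          rw [hf j fun s => f (Multiset.replicate j (m + 1) + s)]
          simp only [← Multiset.coe_add, Multiset.coe_replicate]
        rw [Finset.sum_congr rfl this, Finset.sum_const, hT, smul_eq_mul]
      · rfl

/-- A sum over permutations of a function of the cycle lengths. -/
theorem Equiv.Perm.sum_parts_eq_sumMultisets (n : ℕ) (F : Multiset ℕ → ℕ) :
    ∑ σ : Equiv.Perm (Fin n), F σ.parts =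
      sumMultisets (fun _ _ => 1) n n fun L =>
        n.factorial / (L : Multiset ℕ).centralizerCard * F L := by
  -- Partitions are multisets of naturals weighted by themselves: there is one object of each
  -- weight, so all multichoose factors are 1.
  have h1 : ∀ m, Nat.card {k : ℕ // id k = m} = 1 := fun m => by simp
  obtain ⟨S, hS, hf⟩ := exists_finset_sum_eq_sumMultisets (id : ℕ → ℕ)
    (fun m _ => Nat.finite_of_card_ne_zero (by rw [h1]; exact one_ne_zero)) n n
  rw [sum_parts_eq_sum_partitions S]
  · have := hf fun s => n.factorial / s.centralizerCard * F s
    simp only [Multiset.map_id, h1, Nat.multichoose_one] at this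
    exact this
  · intro s
    rw [hS, Multiset.map_id]
    refine ⟨fun h => ⟨fun x hx => (h.1 x hx).1, h.2⟩, fun h => ⟨fun x hx => ⟨h.1 x hx, ?_⟩, h.2⟩⟩
    rw [← h.2]
    exact Multiset.le_sum_of_mem hx

instance (n : ℕ) : Finite (UnlabeledRegularDigraph 2 n) :=
  have : Finite (LabeledRegularDigraph 2 n) := Finite.of_surjective
    (fun π => (⟨.ofPerm π, MultiDigraph.isRegular_ofPerm π⟩ : LabeledRegularDigraph 2 n))
    fun D => by
      obtain ⟨π, hπ⟩ := MultiDigraph.exists_ofPerm_eq D.2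
      exact ⟨π, Subtype.ext hπ⟩
  Quotient.finite _

namespace RegularDigraphClass

theorem finite_connected (m : ℕ) : Finite {c : Connected 2 // c.1.size = m} := by
  have : Finite {q : RegularDigraphClass 2 // q.size = m} := Finite.of_equiv _ (equivUnlabeled 2 m)
  exact Finite.of_injective
    (fun c => (⟨c.1.1, c.2⟩ : {q : RegularDigraphClass 2 // q.size = m}))
    fun c d h => Subtype.ext (Subtype.ext (congrArg (fun q => q.1) h))

theorem exists_finset (n : ℕ) : ∃ S : Finset (Multiset (Connected 2)),
    (∀ s, s ∈ S ↔ (s.map fun d => d.1.size).sum = n) ∧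
    ∀ f : Multiset ℕ → ℕ, ∑ s ∈ S, f (s.map fun d => d.1.size) =
      sumMultisets (fun l j => (numUnlabeledComponents 2 l 1).multichoose j) n n fun L => f L := by
  obtain ⟨S, hS, hf⟩ := exists_finset_sum_eq_sumMultisets (fun d : Connected 2 => d.1.size)
    (fun m _ => finite_connected m) n n
  refine ⟨S, fun s => ?_, fun f => ?_⟩
  · rw [hS]
    refine ⟨And.right, fun h => ⟨fun x hx => ⟨one_le_size x, ?_⟩, h⟩⟩
    rw [← h]
    exact Multiset.le_sum_of_mem (Multiset.mem_map_of_mem (fun d : Connected 2 => d.1.size) hx)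
  · rw [hf]
    simp only [card_connected_size_eq]

end RegularDigraphClass

/-! ### Counting digraphs by their connected components. -/

/-- The numbers of digraphs in terms of the numbers of connected ones. -/
theorem numUnlabeled_eq_sumMultisets (n : ℕ) :
    numUnlabeled 2 n = sumMultisets (fun l j => (numUnlabeledComponents 2 l 1).multichoose j) n n
      fun _ => 1 := by
  obtain ⟨S, hS, hf⟩ := RegularDigraphClass.exists_finset n
  rw [RegularDigraphClass.numUnlabeled_eq_card, ← hf fun _ => 1, ← Finset.card_eq_sum_ones,
    ← Nat.card_eq_finsetCard]
  exact Nat.card_congr (Equiv.subtypeEquivRight fun s => (hS s).symm)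

theorem numUnlabeledComponents_eq_sumMultisets (n c : ℕ) :
    numUnlabeledComponents 2 n c =
      sumMultisets (fun l j => (numUnlabeledComponents 2 l 1).multichoose j) n n
        fun L => if L.length = c then 1 else 0 := by
  obtain ⟨S, hS, hf⟩ := RegularDigraphClass.exists_finset n
  have h := hf fun s => if s.card = c then 1 else 0
  simp only [Multiset.card_map] at h
  refine Eq.trans ?_ h
  rw [RegularDigraphClass.numUnlabeledComponents_eq_card, ← Finset.card_filter,
    ← Nat.card_eq_finsetCard]
  exact Nat.card_congr (Equiv.subtypeEquivRight fun s => by rw [Finset.mem_filter, hS])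

/-! ### A computable form of the Burnside sum. -/

/-- Computes `Multiset.centralizerCard`. -/
def centralizerCardList : List ℕ → ℕ
  | [] => 1
  | a :: L => a * (L.count a + 1) * centralizerCardList L

theorem centralizerCardList_eq (L : List ℕ) :
    centralizerCardList L = (L : Multiset ℕ).centralizerCard := by
  induction L with
  | nil => simp [centralizerCardList, Multiset.centralizerCard]
  | cons a L ih =>
    rw [← Multiset.cons_coe, Multiset.centralizerCard_cons, ← ih, Multiset.coe_count,
      centralizerCardList]

/-- Formal sums of sorted lists, with coefficients. -/
abbrev ListSum : Type := List (List ℕ × ℕ)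

namespace ListSum

/-- The value of a linear functional on a formal sum. -/
def eval (P : ListSum) (f : List ℕ → ℕ) : ℕ := (P.map fun t => t.2 * f t.1).sum

/-- Adds a term to a formal sum. -/
def addTerm (k : List ℕ) (c : ℕ) : ListSum → ListSum
  | [] => [(k, c)]
  | (k', c') :: P => if k = k' then (k', c + c') :: P else (k', c') :: addTerm k c P

@[simp]
theorem eval_nil (f : List ℕ → ℕ) : eval [] f = 0 := rfl

@[simp]
theorem eval_cons (t : List ℕ × ℕ) (P : ListSum) (f : List ℕ → ℕ) :
    eval (t :: P) f = t.2 * f t.1 + eval P f := rfl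

theorem eval_addTerm (k : List ℕ) (c : ℕ) (P : ListSum) (f : List ℕ → ℕ) :
    eval (addTerm k c P) f = c * f k + eval P f := by
  induction P with
  | nil => rfl
  | cons t P ih =>
    rw [addTerm]
    split_ifs with h
    · subst h
      simp only [eval_cons]
      ring
    · simp only [eval_cons, ih]
      ring

/-- All keys satisfy `p`. -/
def All (p : List ℕ → Prop) (P : ListSum) : Prop := ∀ t ∈ P, p t.1

theorem All.addTerm {p : List ℕ → Prop} {P : ListSum} (hP : P.All p) {k : List ℕ} (hk : p k)
    (c : ℕ) : (addTerm k c P).All p := by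
  induction P with
  | nil =>
    rintro t (_ | ⟨_, ⟨⟩⟩)
    exact hk
  | cons t P ih =>
    rw [ListSum.addTerm]
    have hP' : All p P := fun x hx => hP x (List.mem_cons_of_mem _ hx)
    split_ifs with h
    · intro x hx
      rcases List.mem_cons.1 hx with rfl | hx
      · exact hP t List.mem_cons_self
      · exact hP' x hx
    · intro x hx
      rcases List.mem_cons.1 hx with rfl | hx
      · exact hP _ List.mem_cons_self
      · exact ih hP' x hx

theorem eval_congr {p : List ℕ → Prop} {P : ListSum} (hP : P.All p) {f g : List ℕ → ℕ}
    (h : ∀ L, p L → f L = g L) : eval P f = eval P g := by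
  induction P with
  | nil => rfl
  | cons t P ih =>
    rw [eval_cons, eval_cons, h _ (hP t List.mem_cons_self),
      ih fun x hx => hP x (List.mem_cons_of_mem _ hx)]

/-- The cycle lengths of the lifts of a permutation to the two-sheeted cover. -/
def lifts : List ℕ → ListSum
  | [] => [([], 1)]
  | l :: L => (lifts L).foldr (fun t Q =>
      addTerm ((t.1.orderedInsert (· ≤ ·) l).orderedInsert (· ≤ ·) l) (2 ^ (l - 1) * t.2)
        (addTerm (t.1.orderedInsert (· ≤ ·) (2 * l)) (2 ^ (l - 1) * t.2) Q)) []

theorem lifts_all_sorted (L : List ℕ) : (lifts L).All (List.Pairwise (· ≤ ·)) := by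
  induction L with
  | nil =>
    rintro t (_ | ⟨_, ⟨⟩⟩)
    exact List.Pairwise.nil
  | cons l L ih =>
    rw [lifts]
    generalize lifts L = P at ih
    induction P with
    | nil => intro t ht; simp at ht
    | cons t P ihP =>
      have ht := ih t List.mem_cons_self
      exact ((ihP fun x hx => ih x (List.mem_cons_of_mem _ hx)).addTerm
        (ht.orderedInsert _ _) _).addTerm ((ht.orderedInsert _ _).orderedInsert _ _) _

theorem eval_lifts (L : List ℕ) (f : Multiset ℕ → ℕ) :
    eval (lifts L) (fun K => f K) = Equiv.Perm.sumLifts L f := by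
  induction L generalizing f with
  | nil => simp [lifts, Equiv.Perm.sumLifts]
  | cons l L ih =>
    rw [lifts, Equiv.Perm.sumLifts, ← ih, ← ih]
    generalize lifts L = P
    have h1 : ∀ K : List ℕ, (((K.orderedInsert (· ≤ ·) l).orderedInsert (· ≤ ·) l : List ℕ) :
        Multiset ℕ) = {l, l} + (K : Multiset ℕ) := fun K => by
      refine (Multiset.coe_eq_coe.2 ((List.perm_orderedInsert _ _ _).trans
        ((List.perm_orderedInsert _ _ _).cons _))).trans rfl
    have h2 : ∀ K : List ℕ, ((K.orderedInsert (· ≤ ·) (2 * l) : List ℕ) : Multiset ℕ) =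
        {2 * l} + (K : Multiset ℕ) := fun K =>
      (Multiset.coe_eq_coe.2 (List.perm_orderedInsert _ _ _)).trans rfl
    induction P with
    | nil => rfl
    | cons t P ihP =>
      rw [List.foldr_cons, eval_addTerm, eval_addTerm, ihP, eval_cons, eval_cons, h1, h2]
      ring

/-- The number of fixed pairs of lifts and matchings over a permutation with given cycle
lengths. -/
def pairCount (P : ListSum) : ℕ :=
  eval P fun a => eval P fun b => if a = b then centralizerCardList a else 0

end ListSum

/-- All keys are sorted, so equality of lists decides equality of the multisets of cycle lengths. -/
theorem ListSum.pairCount_lifts (L : List ℕ) :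
    (lifts L).pairCount = Equiv.Perm.sumLifts L fun a => Equiv.Perm.sumLifts L fun b =>
      if a = b then a.centralizerCard else 0 := by
  rw [← eval_lifts]
  refine eval_congr (lifts_all_sorted L) fun a ha => ?_
  rw [← eval_lifts]
  refine eval_congr (lifts_all_sorted L) fun b hb => ?_
  rw [centralizerCardList_eq]
  congr 1
  rw [Multiset.coe_eq_coe]
  exact propext ⟨fun h => h ▸ List.Perm.refl _, fun h => h.eq_of_pairwise' ha hb⟩

theorem Equiv.Perm.sumLifts_perm {L L' : List ℕ} (h : L.Perm L') (f : Multiset ℕ → ℕ) :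
    sumLifts L f = sumLifts L' f := by
  induction h generalizing f with
  | nil => rfl
  | cons a _ ih => simp only [sumLifts, ih]
  | swap a b L =>
    simp only [sumLifts, add_left_comm {a, a}, add_left_comm {2 * a}]
    ring
  | trans _ _ ih ih' => rw [ih, ih']

/-- A closed formula for the number of unlabeled `2`-regular digraphs. -/
theorem numUnlabeled_two_mul_eq_sumMultisets (n : ℕ) :
    numUnlabeled 2 n * (n.factorial * 4 ^ n) =
      sumMultisets (fun _ _ => 1) n n fun L =>
        n.factorial / centralizerCardList L * (ListSum.lifts L).pairCount := by
  -- `toList` chooses an arbitrary order of the cycle lengths, which is harmless by `sumLifts_perm`.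
  let F : Multiset ℕ → ℕ := fun s => Equiv.Perm.sumLifts s.toList fun a =>
    Equiv.Perm.sumLifts s.toList fun b => if a = b then a.centralizerCard else 0
  have hF : ∀ L : List ℕ, F L = (ListSum.lifts L).pairCount := fun L => by
    have hL : (L : Multiset ℕ).toList.Perm L := Multiset.coe_eq_coe.1 (Multiset.coe_toList _)
    rw [ListSum.pairCount_lifts]
    simp only [F, Equiv.Perm.sumLifts_perm hL]
  rw [numUnlabeled_two_mul]
  simp only [centralizerCardList_eq, ← hF]
  rw [← Equiv.Perm.sum_parts_eq_sumMultisets]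
  refine Finset.sum_congr rfl fun σ _ => ?_
  have hσ := (Multiset.coe_toList σ.parts).symm
  rw [Finset.sum_congr rfl fun ε _ => Equiv.Perm.sum_parts_doubleLift σ hσ fun b =>
    if (Equiv.Perm.doubleLift σ ε).parts = b then
      (Equiv.Perm.doubleLift σ ε).parts.centralizerCard else 0]
  exact Equiv.Perm.sum_parts_doubleLift σ hσ fun a =>
    Equiv.Perm.sumLifts σ.parts.toList fun b => if a = b then a.centralizerCard else 0

/-! ### Numerical values. -/

/-- The values of `numUnlabeled`. -/
theorem numUnlabeled_two_eq : ∀ n : Fin 9, numUnlabeled 2 (n.val + 1) =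
    (![1, 3, 8, 25, 85, 397, 2183, 15129, 122585] : Fin 9 → ℕ) n := by
  have h : ∀ n : Fin 9, (sumMultisets (fun _ _ => 1) (n.val + 1) (n.val + 1) fun L =>
      (n.val + 1).factorial / centralizerCardList L * (ListSum.lifts L).pairCount) =
        (![1, 3, 8, 25, 85, 397, 2183, 15129, 122585] : Fin 9 → ℕ) n *
          ((n.val + 1).factorial * 4 ^ (n.val + 1)) := by
    decide +kernel
  intro n
  refine Nat.eq_of_mul_eq_mul_right (m := (n.val + 1).factorial * 4 ^ (n.val + 1))
    (by positivity) ?_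
  rw [numUnlabeled_two_mul_eq_sumMultisets, h]

/-- The numbers of connected digraphs. -/
def connectedCount (n : ℕ) : ℕ :=
  [0, 1, 2, 5, 14, 50, 265, 1601, 11984, 101884].getD n 0

/-- Computes the number of multisets. -/
def multichooseQuot (a j : ℕ) : ℕ := a.ascFactorial j / j.factorial

theorem multichooseQuot_eq (a j : ℕ) : multichooseQuot a j = a.multichoose j := by
  rw [multichooseQuot, Nat.multichoose_eq, Nat.ascFactorial_eq_factorial_mul_choose',
    Nat.mul_div_cancel_left _ j.factorial_pos]

/-- The sum allows only components with at most n nodes on a total of n + 1 nodes, so it accounts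
for the disconnected digraphs. -/
theorem sumMultisets_connectedCount : ∀ n : Fin 9,
    (sumMultisets (fun l j => multichooseQuot (connectedCount l) j) n.val (n.val + 1)
      fun _ => 1) + connectedCount (n.val + 1) =
      (![1, 3, 8, 25, 85, 397, 2183, 15129, 122585] : Fin 9 → ℕ) n := by
  decide +kernel

theorem sumMultisets_zero_right {w : ℕ → ℕ → ℕ} (hw : ∀ l, w l 0 = 1) (m : ℕ)
    (f : List ℕ → ℕ) : sumMultisets w m 0 f = f [] := by
  induction m generalizing f with
  | zero => rfl
  | succ m ih => simp [sumMultisets, hw, ih]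

/-- The largest weight n + 1 can be used at most once, and if it is used nothing else is left. -/
theorem sumMultisets_self {w : ℕ → ℕ → ℕ} (hw : ∀ l, w l 0 = 1) (n : ℕ) (f : List ℕ → ℕ) :
    sumMultisets w (n + 1) (n + 1) f = sumMultisets w n (n + 1) f + w (n + 1) 1 * f [n + 1] := by
  rw [sumMultisets, List.range_succ_eq_map, List.range_succ_eq_map]
  simp [hw, sumMultisets_zero_right hw, Function.comp_def]

/-- By strong induction: the disconnected digraphs involve only smaller connected ones, so
subtracting them from the known total leaves the connected count. -/
theorem numUnlabeledComponents_two_one (n : ℕ) (h1 : 1 ≤ n) (h9 : n ≤ 9) :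
    numUnlabeledComponents 2 n 1 = connectedCount n := by
  induction n using Nat.strong_induction_on with
  | _ n ih =>
    obtain ⟨n, rfl⟩ := Nat.exists_eq_add_of_le' h1
    have h := numUnlabeled_two_eq ⟨n, by omega⟩
    rw [← sumMultisets_connectedCount, numUnlabeled_eq_sumMultisets,
      sumMultisets_self fun l => Nat.multichoose_zero_right _, Nat.multichoose_one_right,
      mul_one] at h
    rw [sumMultisets_congr n (n + 1) _ (w' := fun l j => multichooseQuot (connectedCount l) j)
      fun l j hl hl' => by rw [ih l (by omega) hl (by omega), multichooseQuot_eq]] at h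
    exact Nat.add_left_cancel h

theorem numUnlabeledComponents_two_eq (n c : ℕ) (hn : n ≤ 9) :
    numUnlabeledComponents 2 n c =
      sumMultisets (fun l j => multichooseQuot (connectedCount l) j) n n
        fun L => if L.length = c then 1 else 0 := by
  rw [numUnlabeledComponents_eq_sumMultisets]
  exact sumMultisets_congr n n _ fun l j hl hl' => by
    rw [numUnlabeledComponents_two_one l hl (by omega), multichooseQuot_eq]

theorem sumMultisets_length : ∀ n c : Fin 9,
    (sumMultisets (fun l j => multichooseQuot (connectedCount l) j) (n.val + 1) (n.val + 1)
        fun L => if L.length = c.val + 1 then 1 else 0) =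
      (![![1, 0, 0, 0, 0, 0, 0, 0, 0],
         ![2, 1, 0, 0, 0, 0, 0, 0, 0],
         ![5, 2, 1, 0, 0, 0, 0, 0, 0],
         ![14, 8, 2, 1, 0, 0, 0, 0, 0],
         ![50, 24, 8, 2, 1, 0, 0, 0, 0],
         ![265, 93, 28, 8, 2, 1, 0, 0, 0],
         ![1601, 435, 108, 28, 8, 2, 1, 0, 0],
         ![11984, 2486, 507, 113, 28, 8, 2, 1, 0],
         ![101884, 17211, 2811, 527, 113, 28, 8, 2, 1]] : Fin 9 → Fin 9 → ℕ) n c := by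
  decide +kernel

theorem sum_sumMultisets_length : ∀ n : Fin 9, ∑ c ∈ Finset.Icc 1 (n.val + 1),
    (sumMultisets (fun l j => multichooseQuot (connectedCount l) j) (n.val + 1) (n.val + 1)
        fun L => if L.length = c then 1 else 0) =
      (![1, 3, 8, 25, 85, 397, 2183, 15129, 122585] : Fin 9 → ℕ) n := by
  decide +kernel

/-- Unlabeled regular digraphs are the orbits of regular matrices. -/
theorem exists_equiv_regularMatrixOrbit (k n : ℕ) :
    ∃ f : UnlabeledRegularDigraph k n ≃ RegularMatrixOrbit k n,
      ∀ D : LabeledRegularDigraph k n,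
        f (Quotient.mk (LabeledRegularDigraph.isoSetoid k n) D) =
          Quotient.mk (MulAction.orbitRel (Equiv.Perm (Fin n)) (RegularMatrix k n))
            D.toMatrix := by
  have hiff : ∀ D E : LabeledRegularDigraph k n, D.1.Isomorphic E.1 ↔
      ∃ σ : Equiv.Perm (Fin n), σ • E.toMatrix = D.toMatrix := by
    intro D E
    -- The orbit relation moves the second matrix to the first, so the isomorphism is reversed to
    -- match.
    have h : D.1.Isomorphic E.1 ↔ E.1.Isomorphic D.1 := ⟨fun h => h.symm, fun h => h.symm⟩
    rw [h, MultiDigraph.isomorphic_iff_count]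
    refine exists_congr fun σ => ?_
    constructor
    · intro h
      refine Subtype.ext (Matrix.ext fun i j => ?_)
      change E.1.arcs.count (σ.symm i, σ.symm j) = D.1.arcs.count (i, j)
      rw [← h, Equiv.apply_symm_apply, Equiv.apply_symm_apply]
    · intro h u v
      rw [show D.1.arcs.count (σ u, σ v) = D.toMatrix.1 (σ u) (σ v) from rfl, ← h]
      change E.1.arcs.count (σ.symm (σ u), σ.symm (σ v)) = _
      rw [Equiv.symm_apply_apply, Equiv.symm_apply_apply]
  refine ⟨Equiv.ofBijective (Quotient.map LabeledRegularDigraph.toMatrix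
    fun D E h => (hiff D E).1 h) ⟨?_, ?_⟩, fun D => rfl⟩
  · rintro ⟨D⟩ ⟨E⟩ h
    exact Quotient.sound ((hiff D E).2 (Quotient.exact h))
  · rintro ⟨A⟩
    refine ⟨Quotient.mk _ ⟨.ofCount A.1, MultiDigraph.isRegular_iff_count.2 fun v => ?_⟩, ?_⟩
    · exact ⟨(Finset.sum_congr rfl fun u _ => MultiDigraph.count_ofCount A.1 v u).trans (A.2.1 v),
        (Finset.sum_congr rfl fun u _ => MultiDigraph.count_ofCount A.1 u v).trans (A.2.2 v)⟩
    · refine congrArg (Quotient.mk _) (Subtype.ext (Matrix.ext fun i j => ?_))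
      exact MultiDigraph.count_ofCount A.1 i j

theorem mainTheorem1 :
    -- the table of `U_2(n, c)`, rows `n = 1, …, 9`, columns `c = 1, …, 9`; blanks are zeros
    (∀ n c : Fin 9, numUnlabeledComponents 2 (n.val + 1) (c.val + 1) =
      (!![     1,     0,    0,   0,   0,  0, 0, 0, 0;
               2,     1,    0,   0,   0,  0, 0, 0, 0;
               5,     2,    1,   0,   0,  0, 0, 0, 0;
              14,     8,    2,   1,   0,  0, 0, 0, 0;
              50,    24,    8,   2,   1,  0, 0, 0, 0;
             265,    93,   28,   8,   2,  1, 0, 0, 0;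
            1601,   435,  108,  28,   8,  2, 1, 0, 0;
           11984,  2486,  507, 113,  28,  8, 2, 1, 0;
          101884, 17211, 2811, 527, 113, 28, 8, 2, 1] : Matrix (Fin 9) (Fin 9) ℕ) n c) ∧
    -- the last column of the table
    (∀ n : Fin 9, numUnlabeled 2 (n.val + 1) =
      (![1, 3, 8, 25, 85, 397, 2183, 15129, 122585] : Fin 9 → ℕ) n) ∧
    -- the last column consists of the row sums
    (∀ n : Fin 9, numUnlabeled 2 (n.val + 1) =
      ∑ c ∈ Finset.Icc 1 (n.val + 1), numUnlabeledComponents 2 (n.val + 1) c) ∧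
    -- taking adjacency matrices identifies unlabeled digraphs with orbits of matrices
    (∀ n : ℕ, ∃ f : UnlabeledRegularDigraph 2 n ≃ RegularMatrixOrbit 2 n,
      ∀ D : LabeledRegularDigraph 2 n,
        f (Quotient.mk (LabeledRegularDigraph.isoSetoid 2 n) D) =
          Quotient.mk (MulAction.orbitRel (Equiv.Perm (Fin n)) (RegularMatrix 2 n)) D.toMatrix) ∧
    -- the same numbers count the orbits of matrices
    (∀ n : Fin 9, Nat.card (RegularMatrixOrbit 2 (n.val + 1)) =
      (![1, 3, 8, 25, 85, 397, 2183, 15129, 122585] : Fin 9 → ℕ) n) := by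
  have hU : ∀ n : Fin 9, numUnlabeled 2 (n.val + 1) =
      ∑ c ∈ Finset.Icc 1 (n.val + 1), numUnlabeledComponents 2 (n.val + 1) c := by
    intro n
    rw [numUnlabeled_two_eq, ← sum_sumMultisets_length]
    exact Finset.sum_congr rfl fun c _ => (numUnlabeledComponents_two_eq _ _ (by omega)).symm
  refine ⟨fun n c => ?_, numUnlabeled_two_eq, hU, exists_equiv_regularMatrixOrbit 2, fun n => ?_⟩
  · rw [numUnlabeledComponents_two_eq _ _ (by omega)]
    exact sumMultisets_length n c
  · rw [← numUnlabeled_two_eq]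
    obtain ⟨f, -⟩ := exists_equiv_regularMatrixOrbit 2 (n.val + 1)
    exact Nat.card_congr f.symm
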